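/- Let $\mathbb K$ be an algebraically closed field and $I$ a finite set. A Borcherds–Cartan datum on $I$ consists of an integer matrix $(a_{ij})_{i,j\in I}$ with $a_{ii}\in\{2,0,-2,-4,\dots\}$ and $a_{ij}\le 0$ for $i\ne j$, and of positive integers $r_i$ with $r_ia_{ij}=r_ja_{ji}$ for all $i,j$. Put $i\cdot j=r_ia_{ij}$, $I^+=\{i: a_{ii}=2\}$ and $I^-=\{i: a_{ii}\le 0\}$. Let $\nu=\sum_i\nu_i i\in\mathbb N[I]$, $n=\sum_i\nu_i$, and let $\mathrm{Seq}(\nu)$ be the set of sequences $\mathbf i=i_1\cdots i_n$ in $I$ with $i_1+\cdots+i_n=\nu$. The group $S_n=\langle s_1,\dots,s_{n-1}\rangle$ acts on $\mathrm{Seq}(\nu)$ by place permutation: the entry of $\omega(\mathbf i)$ at place $\omega(a)$ is $i_a$. The algebra $R(\nu)$ is the unital associative $\mathbb K$-algebra generated by $1_{\mathbf i}$, $x_{k,\mathbf i}$ ($1\le k\le n$), $\tau_{k,\mathbf i}$ ($1\le k\le n-1$), for $\mathbf i\in\mathrm{Seq}(\nu)$ (the diagrams with bottom sequence $\mathbf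 i$ that are, respectively, the identity, a dot on the $k$-th strand, and a crossing of the strands $k$ and $k+1$), subject to the following relations. (a) $1_{\mathbf i}1_{\mathbf j}=\delta_{\mathbf i\mathbf j}1_{\mathbf i}$, $\sum_{\mathbf i}1_{\mathbf i}=1$, $x_{k,\mathbf i}=1_{\mathbf i}x_{k,\mathbf i}=x_{k,\mathbf i}1_{\mathbf i}$, $\tau_{k,\mathbf i}=1_{s_k\mathbf i}\tau_{k,\mathbf i}=\tau_{k,\mathbf i}1_{\mathbf i}$. In (b)–(e) we write $x_k=\sum_{\mathbf i}x_{k,\mathbf i}$ and $\tau_k=\sum_{\mathbf i}\tau_{k,\mathbf i}$. (b) $x_kx_l=x_lx_k$; $\tau_kx_l=x_l\tau_k$ if $l\ne k,k+1$; $\tau_k\tau_l=\tau_l\tau_k$ if $|k-l|>1$. (c) $\tau_k^21_{\mathbf i}$ equals $0$ if $i_k=i_{k+1}$; $1_{\mathbf i}$ if $i_k\neq i_{k+1}$ and $i_k\cdot i_{k+1}=0$; and $(x_k^{-a_{i_ki_{k+1}}}+x_{k+1}^{-a_{i_{k+1}i_k}})1_{\mathbf i}$ if $i_k\ne i_{k+1}$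 and $i_k\cdot i_{k+1}\ne0$. (d) $(x_k\tau_k-\tau_kx_{k+1})1_{\mathbf i}=(\tau_kx_k-x_{k+1}\tau_k)1_{\mathbf i}$, and both are equal to $1_{\mathbf i}$ if $i_k=i_{k+1}\in I^+$ and to $0$ otherwise. (e) $(\tau_k\tau_{k+1}\tau_k-\tau_{k+1}\tau_k\tau_{k+1})1_{\mathbf i}$ equals $\sum_{c=0}^{-a_{ij}-1}x_k^{c}x_{k+2}^{-a_{ij}-1-c}1_{\mathbf i}$ if $i_k=i_{k+2}=i\in I^+$, $i_{k+1}=j\neq i$ and $i\cdot j\ne0$, and equals $0$ otherwise. Let $\mathscr P_{\mathbf i}=\mathbb K[x_1(\mathbf i),\dots,x_n(\mathbf i),y_1(\mathbf i),\dots,y_n(\mathbf i)]$ and $\mathscr P_\nu=\bigoplus_{\mathbf i\in\mathrm{Seq}(\nu)}\mathscr P_{\mathbf i}$. Let $s_k$ be the ring isomorphism $\mathscr P_{\mathbf i}\to\mathscr P_{s_k\mathbf i}$ with $x_a(\mathbf i)\mapsto x_{s_k(a)}(s_k\mathbf i)$ and $y_a(\mathbf i)\mapsto y_{s_k(a)}(s_k\mathbf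 i)$, and let $\widetilde s_k$ be the one with $x_a(\mathbf i)\mapsto x_{s_k(a)}(s_k\mathbf i)$ and $y_a(\mathbf i)\mapsto y_a(s_k\mathbf i)$. Then the following hold. (1) Let $\mathbf i,\mathbf j\in\mathrm{Seq}(\nu)$. For each $\omega\in S_n$ with $\omega(\mathbf i)=\mathbf j$ fix a reduced expression $\omega=s_{k_1}\cdots s_{k_r}$ and put $\widehat\omega_{\mathbf i}=\tau_{k_1}\cdots\tau_{k_r}1_{\mathbf i}$. Then the elements $\widehat\omega_{\mathbf i}\,x_{1,\mathbf i}^{m_1}\cdots x_{n,\mathbf i}^{m_n}$, with $\omega\in S_n$ such that $\omega(\mathbf i)=\mathbf j$ and $m_1,\dots,m_n\in\mathbb N$, form a basis of the $\mathbb K$-vector space $1_{\mathbf j}R(\nu)1_{\mathbf i}$. (2) Orient each edge of the graph with vertex set $I$ in which distinct $i,j$ are joined by an edge if and only if $i\cdot j\neq0$. For every such orientation, $\mathscr P_\nu$ is a faithful $R(\nu)$-module under the action in which $1_{\mathbf j}R(\nu)1_{\mathbf i}$ acts by $0$ on $\mathscr P_{\mathbf k}$ for $\mathbf k\ne\mathbf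 i$ and, for $f\in\mathscr P_{\mathbf i}$, $1_{\mathbf i}f=f$, $x_{k,\mathbf i}f=x_k(\mathbf i)f$ and $$\tau_{k,\mathbf i}f=\begin{cases}s_kf&\text{if } i_k\neq i_{k+1},\ i_k\cdot i_{k+1}=0,\\ \dfrac{f-\widetilde s_kf}{x_k(\mathbf i)-x_{k+1}(\mathbf i)}&\text{if } i_k=i_{k+1}\in I^+,\\ \dfrac{\widetilde s_kf-s_kf}{y_k(\mathbf i)-y_{k+1}(\mathbf i)}&\text{if } i_k=i_{k+1}\in I^-,\\ s_kf&\text{if } i_k\leftarrow i_{k+1},\\ \bigl(x_k(s_k\mathbf i)^{-a_{ji}}+x_{k+1}(s_k\mathbf i)^{-a_{ij}}\bigr)s_kf&\text{if } i=i_k\to i_{k+1}=j.\end{cases}$$ -/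

import Mathlib

namespace KLR

universe u v

/-- A Borcherds-Cartan datum on the index set `I`: an integer matrix `a` with diagonal entries
`2, 0, -2, -4, …`, non-positive off-diagonal entries, and positive integers `r i` such that
`diag(r) * a` is symmetric. -/
structure BorcherdsCartanDatum (I : Type u) where
  a : I → I → ℤ
  r : I → ℤ
  diag : ∀ i, a i i = 2 ∨ (a i i ≤ 0 ∧ Even (a i i))
  offDiag : ∀ i j, i ≠ j → a i j ≤ 0
  r_pos : ∀ i, 0 < r i
  symm : ∀ i j, r i * a i j = r j * a j i

namespace BorcherdsCartanDatum

variable {I : Type u} (D : BorcherdsCartanDatum I)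

/-- The value `i · j = r_i a_ij` of the symmetric bilinear form on two elements of `I`. -/
def form (i j : I) : ℤ := D.r i * D.a i j

/-- `I⁺`: the real indices. The imaginary indices `I⁻` are the remaining ones, for which
`a i i ≤ 0`. -/
def IsReal (i : I) : Prop := D.a i i = 2

/-- The natural number `-a_ij`. It is only used for `i ≠ j`, where `a_ij ≤ 0`. -/
def negA (i j : I) : ℕ := (-D.a i j).toNat

/-- An orientation of each edge (between distinct vertices) of the graph with vertex set `I` and
an edge between `i` and `j` when `i · j ≠ 0`; `arrow i j` means `i → j`. -/
structure Orientation where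
  arrow : I → I → Prop
  edge_of_arrow : ∀ i j, arrow i j → i ≠ j ∧ D.form i j ≠ 0
  arrow_or : ∀ i j, i ≠ j → D.form i j ≠ 0 → arrow i j ∨ arrow j i
  not_both : ∀ i j, arrow i j → ¬ arrow j i

end BorcherdsCartanDatum

section Sequences

variable {I : Type u}

/-- The height of `ν ∈ ℕ[I]`: the sum of its coefficients. -/
noncomputable abbrev ht (ν : I →₀ ℕ) : ℕ := ν.degree

/-- `Seq(ν)`: the sequences `i_1 i_2 … i_n` in `I`, `n = ht(ν)`, with `i_1 + ⋯ + i_n = ν`. -/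
def Seq (ν : I →₀ ℕ) : Type u :=
  {i : Fin (ht ν) → I // ∑ k, Finsupp.single (i k) 1 = ν}

noncomputable instance (ν : I →₀ ℕ) [DecidableEq I] : DecidableEq (Seq ν) :=
  inferInstanceAs (DecidableEq {i : Fin (ht ν) → I // ∑ k, Finsupp.single (i k) 1 = ν})

noncomputable instance (ν : I →₀ ℕ) [Fintype I] [DecidableEq I] : Fintype (Seq ν) :=
  inferInstanceAs (Fintype {i : Fin (ht ν) → I // ∑ k, Finsupp.single (i k) 1 = ν})

/-- The entry of a sequence at a position. -/
def Seq.at {ν : I →₀ ℕ} (i : Seq ν) (k : Fin (ht ν)) : I := i.1 k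

/-- The sequence `ω(i)`, whose entry at position `ω(k)` is the entry of `i` at position `k`. -/
noncomputable def Seq.perm {ν : I →₀ ℕ} (ω : Equiv.Perm (Fin (ht ν))) (i : Seq ν) : Seq ν :=
  ⟨fun k => i.1 (ω.symm k), by
    rw [Equiv.sum_comp ω.symm (fun k => Finsupp.single (i.1 k) 1)]
    exact i.2⟩

/-- Positions `k` (counted from `0`) at which strands `k` and `k + 1` of `n` strands can cross. -/
abbrev Crossing (n : ℕ) : Type := {k : ℕ // k + 1 < n}

/-- The left position `k` of a crossing. -/
def Crossing.lo {n : ℕ} (k : Crossing n) : Fin n := ⟨k.1, Nat.lt_of_succ_lt k.2⟩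

/-- The right position `k + 1` of a crossing. -/
def Crossing.hi {n : ℕ} (k : Crossing n) : Fin n := ⟨k.1 + 1, k.2⟩

/-- The simple transposition `s_k` of `S_n`. -/
def simple {n : ℕ} (k : Crossing n) : Equiv.Perm (Fin n) := Equiv.swap k.lo k.hi

/-- The sequence `s_k(i)`. -/
noncomputable def Seq.sw {ν : I →₀ ℕ} (k : Crossing (ht ν)) (i : Seq ν) : Seq ν := i.perm (simple k)

/-- The permutation `s_{k_1} ⋯ s_{k_r}` given by a word `k_1 … k_r`. -/
def wordPerm {n : ℕ} (w : List (Crossing n)) : Equiv.Perm (Fin n) := (w.map simple).prod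

/-- `w` is a reduced expression of `ω`: an expression of minimal length. -/
def IsReducedExpr {n : ℕ} (w : List (Crossing n)) (ω : Equiv.Perm (Fin n)) : Prop :=
  wordPerm w = ω ∧ ∀ w' : List (Crossing n), wordPerm w' = ω → w.length ≤ w'.length

end Sequences

section Algebra

variable {I : Type u}

/-- The diagrams that generate `R(ν)`: the idempotents `1_i`, the dots `x_{k,i}` and the crossings
`τ_{k,i}`. The sequence `i` is the bottom sequence of the diagram. -/
inductive Gen (ν : I →₀ ℕ) : Type u
  | idem (i : Seq ν) : Gen ν
  | dot (k : Fin (ht ν)) (i : Seq ν) : Gen ν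
  | cross (k : Crossing (ht ν)) (i : Seq ν) : Gen ν

variable (K : Type v) [Field K]

/-- The free generator `1_i`. -/
noncomputable def fe {ν : I →₀ ℕ} (i : Seq ν) : FreeAlgebra K (Gen ν) := FreeAlgebra.ι K (Gen.idem i)

/-- The free generator `x_{k,i}`. -/
noncomputable def fx {ν : I →₀ ℕ} (k : Fin (ht ν)) (i : Seq ν) : FreeAlgebra K (Gen ν) :=
  FreeAlgebra.ι K (Gen.dot k i)

/-- The free generator `τ_{k,i}`. -/
noncomputable def ft {ν : I →₀ ℕ} (k : Crossing (ht ν)) (i : Seq ν) : FreeAlgebra K (Gen ν) :=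
  FreeAlgebra.ι K (Gen.cross k i)

/-- The defining relations of `R(ν)`. A product `A * B` is the diagram `A` on top of `B`. -/
inductive Rel [Fintype I] [DecidableEq I] (D : BorcherdsCartanDatum I) (ν : I →₀ ℕ) :
    FreeAlgebra K (Gen ν) → FreeAlgebra K (Gen ν) → Prop
  -- concatenation of diagrams; the product is zero when the sequences do not match
  | idem_idem (i : Seq ν) : Rel D ν (fe K i * fe K i) (fe K i)
  | idem_ne (i j : Seq ν) : i ≠ j → Rel D ν (fe K i * fe K j) 0
  | idem_sum : Rel D ν (∑ i : Seq ν, fe K i) 1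
  | idem_dot (k : Fin (ht ν)) (i : Seq ν) : Rel D ν (fe K i * fx K k i) (fx K k i)
  | dot_idem (k : Fin (ht ν)) (i : Seq ν) : Rel D ν (fx K k i * fe K i) (fx K k i)
  | idem_cross (k : Crossing (ht ν)) (i : Seq ν) :
      Rel D ν (fe K (i.sw k) * ft K k i) (ft K k i)
  | cross_idem (k : Crossing (ht ν)) (i : Seq ν) : Rel D ν (ft K k i * fe K i) (ft K k i)
  -- planar isotopy: dots and crossings on disjoint sets of strands commute
  | dot_dot (k l : Fin (ht ν)) (i : Seq ν) : Rel D ν (fx K k i * fx K l i) (fx K l i * fx K k i)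
  | dot_cross (k : Crossing (ht ν)) (l : Fin (ht ν)) (i : Seq ν) : l ≠ k.lo → l ≠ k.hi →
      Rel D ν (fx K l (i.sw k) * ft K k i) (ft K k i * fx K l i)
  | cross_cross (k l : Crossing (ht ν)) (i : Seq ν) : k.1 + 1 < l.1 →
      Rel D ν (ft K k (i.sw l) * ft K l i) (ft K l (i.sw k) * ft K k i)
  -- double crossings
  | double_same (k : Crossing (ht ν)) (i : Seq ν) : i.at k.lo = i.at k.hi →
      Rel D ν (ft K k (i.sw k) * ft K k i) 0
  | double_orth (k : Crossing (ht ν)) (i : Seq ν) : i.at k.lo ≠ i.at k.hi →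
      D.form (i.at k.lo) (i.at k.hi) = 0 →
      Rel D ν (ft K k (i.sw k) * ft K k i) (fe K i)
  | double_edge (k : Crossing (ht ν)) (i : Seq ν) : i.at k.lo ≠ i.at k.hi →
      D.form (i.at k.lo) (i.at k.hi) ≠ 0 →
      Rel D ν (ft K k (i.sw k) * ft K k i)
        (fx K k.lo i ^ D.negA (i.at k.lo) (i.at k.hi)
          + fx K k.hi i ^ D.negA (i.at k.hi) (i.at k.lo))
  -- sliding a dot through a crossing
  | slide_real (k : Crossing (ht ν)) (i : Seq ν) : i.at k.lo = i.at k.hi →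
      D.IsReal (i.at k.lo) →
      Rel D ν (fx K k.lo (i.sw k) * ft K k i - ft K k i * fx K k.hi i) (fe K i)
  | slide_real' (k : Crossing (ht ν)) (i : Seq ν) : i.at k.lo = i.at k.hi →
      D.IsReal (i.at k.lo) →
      Rel D ν (ft K k i * fx K k.lo i - fx K k.hi (i.sw k) * ft K k i) (fe K i)
  | slide_other (k : Crossing (ht ν)) (i : Seq ν) :
      ¬ (i.at k.lo = i.at k.hi ∧ D.IsReal (i.at k.lo)) →
      Rel D ν (fx K k.lo (i.sw k) * ft K k i) (ft K k i * fx K k.hi i)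
  | slide_other' (k : Crossing (ht ν)) (i : Seq ν) :
      ¬ (i.at k.lo = i.at k.hi ∧ D.IsReal (i.at k.lo)) →
      Rel D ν (ft K k i * fx K k.lo i) (fx K k.hi (i.sw k) * ft K k i)
  -- triple crossings of the adjacent crossings `k` and `l = k + 1`
  | braid_edge (k l : Crossing (ht ν)) (i : Seq ν) : l.1 = k.1 + 1 →
      i.at k.lo = i.at l.hi → i.at k.lo ≠ i.at l.lo → D.IsReal (i.at k.lo) →
      D.form (i.at k.lo) (i.at l.lo) ≠ 0 →
      Rel D ν
        (ft K k ((i.sw k).sw l) * ft K l (i.sw k) * ft K k i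
          - ft K l ((i.sw l).sw k) * ft K k (i.sw l) * ft K l i)
        (∑ c ∈ Finset.range (D.negA (i.at k.lo) (i.at l.lo)),
          fx K k.lo i ^ c * fx K l.hi i ^ (D.negA (i.at k.lo) (i.at l.lo) - 1 - c) * fe K i)
  | braid_other (k l : Crossing (ht ν)) (i : Seq ν) : l.1 = k.1 + 1 →
      ¬ (i.at k.lo = i.at l.hi ∧ i.at k.lo ≠ i.at l.lo ∧ D.IsReal (i.at k.lo) ∧
        D.form (i.at k.lo) (i.at l.lo) ≠ 0) →
      Rel D ν
        (ft K k ((i.sw k).sw l) * ft K l (i.sw k) * ft K k i)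
        (ft K l ((i.sw l).sw k) * ft K k (i.sw l) * ft K l i)

variable [Fintype I] [DecidableEq I] (D : BorcherdsCartanDatum I) (ν : I →₀ ℕ)

/-- The quiver Hecke algebra `R(ν)`. -/
abbrev R : Type (max u v) := RingQuot (Rel K D ν)

variable {ν}

/-- The idempotent `1_i` of `R(ν)`. -/
noncomputable def e (i : Seq ν) : R K D ν := RingQuot.mkAlgHom K (Rel K D ν) (fe K i)

/-- The element `x_{k,i}` of `R(ν)`. -/
noncomputable def x (k : Fin (ht ν)) (i : Seq ν) : R K D ν :=
  RingQuot.mkAlgHom K (Rel K D ν) (fx K k i)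

/-- The element `τ_{k,i}` of `R(ν)`. -/
noncomputable def t (k : Crossing (ht ν)) (i : Seq ν) : R K D ν :=
  RingQuot.mkAlgHom K (Rel K D ν) (ft K k i)

/-- The subspace `1_j R(ν) 1_i`. -/
noncomputable def component (j i : Seq ν) : Submodule K (R K D ν) :=
  LinearMap.range (LinearMap.mulLeft K (e K D j) ∘ₗ LinearMap.mulRight K (e K D i))

/-- The product `τ_{k_1} ⋯ τ_{k_r} 1_i` of crossings, stacked on the bottom sequence `i`. -/
noncomputable def tWord : List (Crossing (ht ν)) → Seq ν → R K D ν
  | [], i => e K D i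
  | k :: w, i => t K D k (i.perm (wordPerm w)) * tWord w i

/-- The monomial `x_{1,i}^{m_1} ⋯ x_{n,i}^{m_n}`. -/
noncomputable def xMonomial (m : Fin (ht ν) → ℕ) (i : Seq ν) : R K D ν :=
  (List.ofFn fun k => x K D k i ^ m k).prod

end Algebra

section PolynomialRepresentation

variable {I : Type u} (K : Type v) [Field K]

/-- The polynomial ring `K[x_1, …, x_n, y_1, …, y_n]`: `Sum.inl k` is the index of the variable
`x_k` and `Sum.inr k` that of `y_k`. -/
abbrev XY (n : ℕ) : Type v := MvPolynomial (Fin n ⊕ Fin n) K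

/-- The polynomial ring `𝒫_i` in the variables `x_k(i)`, `y_k(i)`. -/
abbrev PolAt {ν : I →₀ ℕ} (_i : Seq ν) : Type v := XY K (ht ν)

/-- `𝒫_ν`: the direct sum of the polynomial rings `𝒫_i` over all `i` in `Seq(ν)`. -/
abbrev Pol (ν : I →₀ ℕ) : Type (max u v) := DirectSum (Seq ν) fun i => PolAt K i

variable {K}

/-- The operator `ω`, permuting the variables `x` and `y` simultaneously. -/
noncomputable def permXY {n : ℕ} (ω : Equiv.Perm (Fin n)) (f : XY K n) : XY K n :=
  MvPolynomial.rename (Sum.map ω ω) f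

/-- The operator `ω̃`, permuting the variables `x` only. -/
noncomputable def permX {n : ℕ} (ω : Equiv.Perm (Fin n)) (f : XY K n) : XY K n :=
  MvPolynomial.rename (Sum.map ω id) f

theorem dvd_sub_rename_swap {σ : Type*} [DecidableEq σ] (a b : σ) (f : MvPolynomial σ K) :
    (MvPolynomial.X a - MvPolynomial.X b : MvPolynomial σ K) ∣
      f - MvPolynomial.rename (Equiv.swap a b) f := by
  induction f using MvPolynomial.induction_on with
  | C c => simp
  | add p q hp hq =>
    rw [map_add, add_sub_add_comm]
    exact dvd_add hp hq
  | mul_X p s hp =>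
    have h : (MvPolynomial.X a - MvPolynomial.X b : MvPolynomial σ K) ∣
        MvPolynomial.X s - MvPolynomial.X (Equiv.swap a b s) := by
      by_cases h1 : s = a
      · subst h1; simp
      by_cases h2 : s = b
      · subst h2
        rw [Equiv.swap_apply_right]
        exact (dvd_sub_comm).mp dvd_rfl
      · rw [Equiv.swap_apply_of_ne_of_ne h1 h2]; simp
    have h' : ∀ p q r s : MvPolynomial σ K, p * q - r * s = (p - r) * q + r * (q - s) := by
      intros; ring
    rw [map_mul, MvPolynomial.rename_X, h']
    exact dvd_add (hp.mul_right _) (h.mul_left _)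

theorem dvd_sub_permX {n : ℕ} (k : Crossing n) (f : XY K n) :
    (MvPolynomial.X (Sum.inl k.lo) - MvPolynomial.X (Sum.inl k.hi) : XY K n) ∣
      f - permX (simple k) f := by
  have h := dvd_sub_rename_swap (K := K) (Sum.inl k.lo : Fin n ⊕ Fin n) (Sum.inl k.hi) f
  have e : (Equiv.swap (Sum.inl k.lo) (Sum.inl k.hi) : Fin n ⊕ Fin n → Fin n ⊕ Fin n)
      = Sum.map (simple k) id := by
    funext z
    rcases z with z | z
    · simp only [simple, Sum.map_inl, Equiv.swap_apply_def, Sum.inl.injEq]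
      split_ifs <;> rfl
    · simp [Equiv.swap_apply_def]
  rw [e] at h
  exact h

theorem dvd_permX_sub_permXY {n : ℕ} (k : Crossing n) (f : XY K n) :
    (MvPolynomial.X (Sum.inr k.lo) - MvPolynomial.X (Sum.inr k.hi) : XY K n) ∣
      permX (simple k) f - permXY (simple k) f := by
  have h := dvd_sub_rename_swap (K := K) (Sum.inr k.lo : Fin n ⊕ Fin n) (Sum.inr k.hi)
    (permX (simple k) f)
  have e : (Equiv.swap (Sum.inr k.lo) (Sum.inr k.hi) : Fin n ⊕ Fin n → Fin n ⊕ Fin n)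
      ∘ Sum.map (simple k) id = Sum.map (simple k) (simple k) := by
    funext z
    rcases z with z | z
    · simp [Equiv.swap_apply_def]
    · simp only [simple, Function.comp, Sum.map_inr, Equiv.swap_apply_def, Sum.inr.injEq, id]
      split_ifs <;> rfl
  simp only [permX, MvPolynomial.rename_rename] at h
  rw [e] at h
  exact h

/-- The exact quotient `(f - s̃_k f) / (x_k - x_{k+1})`: the polynomial `q` with
`f - s̃_k f = (x_k - x_{k+1}) * q`. -/
noncomputable def realDiff {n : ℕ} (k : Crossing n) (f : XY K n) : XY K n :=
  (dvd_sub_permX k f).choose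

/-- The exact quotient `(s̃_k f - s_k f) / (y_k - y_{k+1})`: the polynomial `q` with
`s̃_k f - s_k f = (y_k - y_{k+1}) * q`. -/
noncomputable def imagDiff {n : ℕ} (k : Crossing n) (f : XY K n) : XY K n :=
  (dvd_permX_sub_permXY k f).choose

theorem realDiff_spec {n : ℕ} (k : Crossing n) (f : XY K n) :
    f - permX (simple k) f =
      (MvPolynomial.X (Sum.inl k.lo) - MvPolynomial.X (Sum.inl k.hi)) * realDiff k f :=
  (dvd_sub_permX k f).choose_spec

theorem imagDiff_spec {n : ℕ} (k : Crossing n) (f : XY K n) :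
    permX (simple k) f - permXY (simple k) f =
      (MvPolynomial.X (Sum.inr k.lo) - MvPolynomial.X (Sum.inr k.hi)) * imagDiff k f :=
  (dvd_permX_sub_permXY k f).choose_spec

variable {D : BorcherdsCartanDatum I} {ν : I →₀ ℕ}

open Classical in
/-- The map `𝒫_i → 𝒫_{s_k(i)}` by which `τ_{k,i}` acts. In the last case `i_k → i_{k+1}`. -/
noncomputable def crossOp (O : D.Orientation) (k : Crossing (ht ν)) (i : Seq ν)
    (f : PolAt K i) : PolAt K (i.sw k) :=
  if i.at k.lo = i.at k.hi then
    if D.IsReal (i.at k.lo) then realDiff k f else imagDiff k f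
  else if D.form (i.at k.lo) (i.at k.hi) = 0 then permXY (simple k) f
  else if O.arrow (i.at k.hi) (i.at k.lo) then permXY (simple k) f
  else
    (MvPolynomial.X (Sum.inl k.lo) ^ D.negA (i.at k.hi) (i.at k.lo)
      + MvPolynomial.X (Sum.inl k.hi) ^ D.negA (i.at k.lo) (i.at k.hi)) * permXY (simple k) f

variable [Fintype I] [DecidableEq I]

/-- The polynomial `f` placed in the summand `𝒫_i` of `𝒫_ν`. -/
noncomputable def Pol.of (i : Seq ν) (f : PolAt K i) : Pol K ν :=
  DirectSum.lof K (Seq ν) (fun i => PolAt K i) i f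

/-- `ρ` is the action of `R(ν)` on `𝒫_ν` in which `1_j R(ν) 1_i` acts by `0` on `𝒫_k` for `k ≠ i`
and the generators act on `𝒫_i` by the formulas for the polynomial representation. -/
structure IsPolynomialAction (O : D.Orientation)
    (ρ : R K D ν →ₐ[K] Module.End K (Pol K ν)) : Prop where
  zero : ∀ (i j k : Seq ν), i ≠ k → ∀ z ∈ component K D j i, ∀ f : PolAt K k,
    ρ z (Pol.of k f) = 0
  idem : ∀ (i : Seq ν) (f : PolAt K i), ρ (e K D i) (Pol.of i f) = Pol.of i f
  dot : ∀ (k : Fin (ht ν)) (i : Seq ν) (f : PolAt K i),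
    ρ (x K D k i) (Pol.of i f) = Pol.of i (MvPolynomial.X (Sum.inl k) * f)
  cross : ∀ (k : Crossing (ht ν)) (i : Seq ν) (f : PolAt K i),
    ρ (t K D k i) (Pol.of i f) = Pol.of (i.sw k) (crossOp O k i f)

end PolynomialRepresentation

end KLR

/-! Spanning. Filter R(ν)1_i by the length of words of crossings, with dots at the bottom
(`wordSpan`). Dots and idempotents preserve the filtration, because sliding a dot through a crossing
only creates terms with that crossing removed; a crossing raises it by one. The defects of the
double-crossing and braid relations are polynomials in the dots, so they too have lower length. By
Matsumoto's theorem (`braidEq_of_reduced`) two reduced words of one permutation therefore agree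
modulo shorter words, and a non-reduced word can be brought to contain a repeated adjacent letter
and so is itself a combination of shorter ones. Induction on length leaves only the chosen reduced
expressions (`span_eq_component`).

The representation. Over the fraction field K(x,y) each crossing acts as α·g + β·h with g, h in S_n
× S_n permuting the x and the y separately. Polynomials embed in that field, so the relations become
identities between a few commuting or braiding swaps (`fieldCross_*`, `freeAction_rel`).

Independence and faithfulness. The operator of a reduced word of ω expands as ∑ c_g g over S_n ×
S_n. Among the g that occur, exactly one has maximal weight, where the weight counts inversions of
the x-part between equal real labels and of the y-part between equal imaginary labels; the x-part of
that g is ω (`exists_leading`). Distinct automorphisms are linearly independent over the field, so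
in a relation ∑ τ_ω p_ω(x) = 0 the leading automorphism of an ω of maximal weight with p_ω ≠ 0 could
not cancel (`eq_zero_of_sum_expansion`). Hence the spanning elements act by independent operators.
They are then independent themselves, and no nonzero element of their span acts by zero. -/

namespace KLR

universe u v

/-! ### Inversions, reduced words and Matsumoto's theorem for the symmetric group. -/

section Words

variable {n : ℕ}

theorem Crossing.lo_lt_hi (k : Crossing n) : k.lo < k.hi := Nat.lt_succ_self k.1

theorem Crossing.lo_ne_hi (k : Crossing n) : k.lo ≠ k.hi := k.lo_lt_hi.ne

@[simp] theorem simple_lo (k : Crossing n) : simple k k.lo = k.hi := Equiv.swap_apply_left _ _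

@[simp] theorem simple_hi (k : Crossing n) : simple k k.hi = k.lo := Equiv.swap_apply_right _ _

theorem simple_of_ne (k : Crossing n) {l : Fin n} (h : l ≠ k.lo) (h' : l ≠ k.hi) :
    simple k l = l := Equiv.swap_apply_of_ne_of_ne h h'

@[simp] theorem simple_inv (k : Crossing n) : (simple k)⁻¹ = simple k := Equiv.swap_inv _ _

@[simp] theorem simple_mul_self (k : Crossing n) : simple k * simple k = 1 :=
  Equiv.swap_mul_self _ _

@[simp] theorem simple_simple (k : Crossing n) (l : Fin n) : simple k (simple k l) = l :=
  Equiv.swap_apply_self _ _ _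

theorem simple_mul_cancel (k : Crossing n) (ω : Equiv.Perm (Fin n)) :
    simple k * (simple k * ω) = ω := by
  rw [← mul_assoc, simple_mul_self, one_mul]

theorem simple_lt_iff (k : Crossing n) (c d : Fin n) (h : ¬ (c = k.lo ∧ d = k.hi))
    (h' : ¬ (c = k.hi ∧ d = k.lo)) : simple k c < simple k d ↔ c < d := by
  obtain ⟨k, hk⟩ := k
  simp only [simple, Equiv.swap_apply_def, Crossing.lo, Crossing.hi, Fin.ext_iff, Fin.lt_def]
    at h h' ⊢
  split_ifs <;> simp only <;> omega

theorem val_simple (k : Crossing n) (c : Fin n) : (simple k c : ℕ) =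
    if c.1 = k.1 then k.1 + 1 else if c.1 = k.1 + 1 then k.1 else c.1 := by
  simp only [simple, Equiv.swap_apply_def, Crossing.lo, Crossing.hi, Fin.ext_iff]
  split_ifs <;> rfl

theorem simple_comm {k l : Crossing n} (h : k.1 + 1 < l.1) :
    simple k * simple l = simple l * simple k := by
  ext c
  simp only [Equiv.Perm.mul_apply, val_simple]
  split_ifs <;> omega

theorem lo_eq_hi_of_adjacent {k l : Crossing n} (h : l.1 = k.1 + 1) :
    l.lo = k.hi := Fin.ext h

theorem hi_ne_lo_of_adjacent {k l : Crossing n} (h : l.1 = k.1 + 1) :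
    l.hi ≠ k.lo := by
  simp only [Crossing.lo, Crossing.hi, ne_eq, Fin.ext_iff]; omega

theorem hi_ne_hi_of_adjacent {k l : Crossing n} (h : l.1 = k.1 + 1) :
    l.hi ≠ k.hi := by
  simp only [Crossing.hi, ne_eq, Fin.ext_iff]; omega

theorem simple_left_hi {k l : Crossing n} (h : l.1 = k.1 + 1) :
    simple k l.hi = l.hi :=
  simple_of_ne k (hi_ne_lo_of_adjacent h) (hi_ne_hi_of_adjacent h)

theorem simple_right_lo {k l : Crossing n} (h : l.1 = k.1 + 1) :
    simple l k.lo = k.lo :=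
  simple_of_ne l (lo_eq_hi_of_adjacent h ▸ k.lo_ne_hi) (hi_ne_lo_of_adjacent h).symm

theorem simple_right_mid {k l : Crossing n} (h : l.1 = k.1 + 1) :
    simple l k.hi = l.hi := by
  rw [← lo_eq_hi_of_adjacent h, simple_lo]

theorem simple_braid {k l : Crossing n} (h : l.1 = k.1 + 1) :
    simple k * simple l * simple k = simple l * simple k * simple l := by
  have h1 := simple_left_hi h
  have h2 := simple_right_lo h
  have h3 := simple_right_mid h
  have h4 : simple l l.hi = k.hi := by rw [simple_hi, lo_eq_hi_of_adjacent h]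
  refine Equiv.ext fun c => ?_
  simp only [Equiv.Perm.mul_apply]
  by_cases c1 : c = k.lo
  · subst c1; simp [h1, h2, h3]
  by_cases c2 : c = k.hi
  · subst c2; simp [h1, h2, h3, h4]
  by_cases c3 : c = l.hi
  · subst c3; simp only [h1, h2, h4, simple_hi]
  have c4 : c ≠ l.lo := lo_eq_hi_of_adjacent h ▸ c2
  simp [simple_of_ne k c1 c2, simple_of_ne l c4 c3]

open Classical in
/-- The inversions of `σ` among the pairs related by `P`. -/
noncomputable def invSet (P : Fin n → Fin n → Prop) (σ : Equiv.Perm (Fin n)) :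
    Finset (Fin n × Fin n) :=
  Finset.univ.filter fun p => p.1 < p.2 ∧ P p.1 p.2 ∧ σ p.2 < σ p.1

/-- The number of inversions of `σ` among the pairs related by `P`. -/
noncomputable def inv (P : Fin n → Fin n → Prop) (σ : Equiv.Perm (Fin n)) : ℕ :=
  (invSet P σ).card

/-- The number of all inversions of `σ`. -/
noncomputable abbrev len (σ : Equiv.Perm (Fin n)) : ℕ := inv (fun _ _ => True) σ

theorem mem_invSet {P : Fin n → Fin n → Prop} {σ : Equiv.Perm (Fin n)} {p : Fin n × Fin n} :
    p ∈ invSet P σ ↔ p.1 < p.2 ∧ P p.1 p.2 ∧ σ p.2 < σ p.1 := by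
  simp [invSet]

/-- Left multiplication by s_k only changes the relative order of the values k and k+1. -/
theorem mem_invSet_simple_mul {P : Fin n → Fin n → Prop} (k : Crossing n)
    (σ : Equiv.Perm (Fin n)) (p : Fin n × Fin n) (h : ¬ (σ p.1 = k.lo ∧ σ p.2 = k.hi))
    (h' : ¬ (σ p.1 = k.hi ∧ σ p.2 = k.lo)) :
    p ∈ invSet P (simple k * σ) ↔ p ∈ invSet P σ := by
  simp only [mem_invSet, Equiv.Perm.mul_apply]
  rw [simple_lt_iff k _ _ (fun g => h' g.symm) (fun g => h g.symm)]

theorem inv_simple_mul_of_not {P : Fin n → Fin n → Prop} (k : Crossing n)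
    (σ : Equiv.Perm (Fin n)) (h : ¬ P (σ⁻¹ k.lo) (σ⁻¹ k.hi)) (h' : ¬ P (σ⁻¹ k.hi) (σ⁻¹ k.lo)) :
    inv P (simple k * σ) = inv P σ := by
  refine congrArg Finset.card (Finset.ext fun p => ?_)
  by_cases h1 : σ p.1 = k.lo ∧ σ p.2 = k.hi
  · rw [← h1.1, ← h1.2, Equiv.Perm.inv_def, Equiv.symm_apply_apply, Equiv.symm_apply_apply] at h
    exact iff_of_false (fun g => h (mem_invSet.1 g).2.1) fun g => h (mem_invSet.1 g).2.1
  by_cases h2 : σ p.1 = k.hi ∧ σ p.2 = k.lo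
  · rw [← h2.1, ← h2.2, Equiv.Perm.inv_def, Equiv.symm_apply_apply, Equiv.symm_apply_apply] at h'
    exact iff_of_false (fun g => h' (mem_invSet.1 g).2.1) fun g => h' (mem_invSet.1 g).2.1
  exact mem_invSet_simple_mul k σ p h1 h2

theorem inv_simple_mul_of_lt {P : Fin n → Fin n → Prop} (k : Crossing n)
    (σ : Equiv.Perm (Fin n)) (hlt : σ⁻¹ k.lo < σ⁻¹ k.hi) (h : P (σ⁻¹ k.lo) (σ⁻¹ k.hi)) :
    inv P (simple k * σ) = inv P σ + 1 := by
  have hn : (σ⁻¹ k.lo, σ⁻¹ k.hi) ∉ invSet P σ := by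
    simp [mem_invSet, k.lo_lt_hi.le]
  rw [inv, inv, ← Finset.card_insert_of_notMem hn]
  refine congrArg Finset.card (Finset.ext fun p => ?_)
  rw [Finset.mem_insert]
  by_cases h1 : σ p.1 = k.lo ∧ σ p.2 = k.hi
  · have hp : p = (σ⁻¹ k.lo, σ⁻¹ k.hi) := by
      rw [← h1.1, ← h1.2]; simp
    subst hp
    simpa [mem_invSet, k.lo_lt_hi] using And.intro hlt h
  have hp : p ≠ (σ⁻¹ k.lo, σ⁻¹ k.hi) := by
    rintro rfl
    simp at h1
  by_cases h2 : σ p.1 = k.hi ∧ σ p.2 = k.lo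
  · have hp' : p = (σ⁻¹ k.hi, σ⁻¹ k.lo) := by
      rw [← h2.1, ← h2.2]; simp
    subst hp'
    exact iff_of_false (fun g => lt_asymm hlt (mem_invSet.1 g).1)
      fun g => lt_asymm hlt (mem_invSet.1 ((or_iff_right hp).1 g)).1
  rw [mem_invSet_simple_mul k σ p h1 h2, or_iff_right hp]

theorem inv_simple_mul_of_gt {P : Fin n → Fin n → Prop} (k : Crossing n)
    (σ : Equiv.Perm (Fin n)) (hlt : σ⁻¹ k.hi < σ⁻¹ k.lo) (h : P (σ⁻¹ k.hi) (σ⁻¹ k.lo)) :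
    inv P (simple k * σ) + 1 = inv P σ := by
  have := inv_simple_mul_of_lt (P := P) k (simple k * σ) (by simpa using hlt) (by simpa using h)
  rw [simple_mul_cancel] at this
  exact this.symm

/-- Symmetry of `P` is needed because either preimage of the values k, k+1 may be the smaller one.
-/
theorem inv_simple_mul_le {P : Fin n → Fin n → Prop} (hP : ∀ a b, P a b → P b a) (k : Crossing n)
    (σ : Equiv.Perm (Fin n)) : inv P (simple k * σ) ≤ inv P σ + 1 := by
  by_cases h : P (σ⁻¹ k.lo) (σ⁻¹ k.hi)
  · rcases lt_trichotomy (σ⁻¹ k.lo) (σ⁻¹ k.hi) with h1 | h1 | h1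
    · exact (inv_simple_mul_of_lt k σ h1 h).le
    · exact absurd (σ⁻¹.injective h1) k.lo_ne_hi
    · have := inv_simple_mul_of_gt k σ h1 (hP _ _ h)
      omega
  · rw [inv_simple_mul_of_not k σ h (fun g => h (hP _ _ g))]
    exact Nat.le_succ _

theorem inv_perm_one (P : Fin n → Fin n → Prop) : inv P 1 = 0 := by
  rw [inv, Finset.card_eq_zero]
  ext p
  simp only [mem_invSet, Equiv.Perm.one_apply, Finset.notMem_empty, iff_false]
  rintro ⟨h, -, h'⟩
  exact lt_asymm h h'

theorem wordPerm_nil : wordPerm ([] : List (Crossing n)) = 1 := rfl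

theorem wordPerm_cons (k : Crossing n) (w : List (Crossing n)) :
    wordPerm (k :: w) = simple k * wordPerm w := by simp [wordPerm]

theorem len_wordPerm_le (w : List (Crossing n)) : len (wordPerm w) ≤ w.length := by
  induction w with
  | nil => exact (inv_perm_one _).le
  | cons k w ih =>
    rw [wordPerm_cons, List.length_cons]
    exact (inv_simple_mul_le (fun _ _ _ => trivial) k _).trans (Nat.succ_le_succ ih)

/-- Without descents the inverse is strictly increasing, and a finite chain has no order
automorphism but the identity. -/
theorem eq_one_of_forall_lt (ω : Equiv.Perm (Fin n)) (h : ∀ k : Crossing n, ω⁻¹ k.lo < ω⁻¹ k.hi) :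
    ω = 1 := by
  have hm : StrictMono (ω⁻¹ : Equiv.Perm (Fin n)) := by
    cases n with
    | zero => exact fun a => a.elim0
    | succ m =>
      rw [Fin.strictMono_iff_lt_succ]
      intro i
      exact h ⟨i.1, by omega⟩
  have : (ω⁻¹ : Equiv.Perm (Fin n)) = 1 := by
    ext a
    have := Subsingleton.elim (α := Fin n ≃o Fin n)
      (StrictMono.orderIsoOfSurjective _ hm ω⁻¹.surjective) (OrderIso.refl _)
    have h2 := DFunLike.congr_fun this a
    simpa using congrArg Fin.val h2
  simpa using this

/-- Bubble sort: a permutation other than 1 has a descent, and removing it lowers the number of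
inversions by one. -/
theorem exists_reduced (ω : Equiv.Perm (Fin n)) :
    ∃ w : List (Crossing n), wordPerm w = ω ∧ w.length = len ω := by
  induction h : len ω using Nat.strong_induction_on generalizing ω with
  | _ d ih =>
    by_cases h1 : ∀ k : Crossing n, ω⁻¹ k.lo < ω⁻¹ k.hi
    · obtain rfl := eq_one_of_forall_lt ω h1
      exact ⟨[], rfl, by rw [← h, len, inv_perm_one]; rfl⟩
    · push Not at h1
      obtain ⟨k, hk⟩ := h1
      have hk' := lt_of_le_of_ne hk (fun g => k.lo_ne_hi (ω⁻¹.injective g).symm)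
      have h2 := inv_simple_mul_of_gt (P := fun _ _ => True) k ω hk' trivial
      obtain ⟨w, hw, hl⟩ := ih (len (simple k * ω)) (by rw [len] at *; omega) _ rfl
      refine ⟨k :: w, by rw [wordPerm_cons, hw, simple_mul_cancel], ?_⟩
      rw [List.length_cons, hl, h2, ← h]

/-- Each letter adds at most one inversion and sorting attains this bound, so minimal length is the
inversion number. From here on only inversions are used. -/
theorem isReducedExpr_iff (w : List (Crossing n)) (ω : Equiv.Perm (Fin n)) :
    IsReducedExpr w ω ↔ wordPerm w = ω ∧ w.length = len ω := by
  refine and_congr_right fun hw => ⟨fun h => ?_, fun h w' hw' => ?_⟩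
  · obtain ⟨w', h1, h2⟩ := exists_reduced ω
    have := len_wordPerm_le w
    rw [hw] at this
    exact le_antisymm (h2 ▸ h w' h1) this
  · rw [h, ← hw']
    exact len_wordPerm_le w'

/-- A word is reduced if its length is the number of inversions of its permutation. -/
def Reduced (w : List (Crossing n)) : Prop := w.length = len (wordPerm w)

/-- Otherwise the letter k would cancel an inversion, leaving the word longer than the inversion
number. -/
theorem Reduced.lt_of_cons {k : Crossing n} {w : List (Crossing n)} (h : Reduced (k :: w)) :
    (wordPerm w)⁻¹ k.lo < (wordPerm w)⁻¹ k.hi := by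
  by_contra hc
  have hc' := lt_of_le_of_ne (not_lt.mp hc) (fun g => k.lo_ne_hi ((wordPerm w)⁻¹.injective g).symm)
  have h1 := inv_simple_mul_of_gt (P := fun _ _ => True) k _ hc' trivial
  have h2 := len_wordPerm_le w
  rw [Reduced, wordPerm_cons, List.length_cons] at h
  rw [len] at *
  omega

theorem Reduced.tail {k : Crossing n} {w : List (Crossing n)} (h : Reduced (k :: w)) :
    Reduced w := by
  have h1 := inv_simple_mul_of_lt (P := fun _ _ => True) k _ h.lt_of_cons trivial
  rw [Reduced, wordPerm_cons, List.length_cons] at h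
  rw [Reduced]
  rw [len] at *
  omega

theorem Reduced.cons {k : Crossing n} {w : List (Crossing n)} (h : Reduced w)
    (hk : (wordPerm w)⁻¹ k.lo < (wordPerm w)⁻¹ k.hi) : Reduced (k :: w) := by
  rw [Reduced, wordPerm_cons, List.length_cons, h]
  exact (inv_simple_mul_of_lt (P := fun _ _ => True) k _ hk trivial).symm

theorem exists_reduced_word (ω : Equiv.Perm (Fin n)) :
    ∃ w : List (Crossing n), wordPerm w = ω ∧ Reduced w := by
  obtain ⟨w, h1, h2⟩ := exists_reduced ω
  exact ⟨w, h1, by rw [Reduced, h1, h2]⟩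

/-- Words that can be obtained from each other by braid moves. -/
inductive BraidEq : List (Crossing n) → List (Crossing n) → Prop
  | refl (w) : BraidEq w w
  | symm {w w'} : BraidEq w w' → BraidEq w' w
  | trans {w w' w''} : BraidEq w w' → BraidEq w' w'' → BraidEq w w''
  | cons (k) {w w'} : BraidEq w w' → BraidEq (k :: w) (k :: w')
  | comm {k l : Crossing n} (w) : k.1 + 1 < l.1 → BraidEq (k :: l :: w) (l :: k :: w)
  | braid {k l : Crossing n} (w) : l.1 = k.1 + 1 → BraidEq (k :: l :: k :: w) (l :: k :: l :: w)

theorem BraidEq.length_eq {w w' : List (Crossing n)} (h : BraidEq w w') :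
    w.length = w'.length := by
  induction h with
  | refl => rfl
  | symm _ ih => exact ih.symm
  | trans _ _ ih ih' => exact ih.trans ih'
  | cons _ _ ih => simp [ih]
  | comm => simp
  | braid => simp

theorem BraidEq.wordPerm_eq {w w' : List (Crossing n)} (h : BraidEq w w') :
    wordPerm w = wordPerm w' := by
  induction h with
  | refl => rfl
  | symm _ ih => exact ih.symm
  | trans _ _ ih ih' => exact ih.trans ih'
  | cons _ _ ih => simp [wordPerm_cons, ih]
  | comm _ h => simp only [wordPerm_cons, ← mul_assoc, simple_comm h]
  | braid _ h => simp only [wordPerm_cons, ← mul_assoc, simple_braid h]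

/-- Two distant descents of ω can both be removed, in either order; `z` spells what remains. This
closes the commuting case of Matsumoto's theorem. -/
theorem exists_comm_word {k l : Crossing n} (h : k.1 + 1 < l.1) (ω : Equiv.Perm (Fin n))
    (hk : ω⁻¹ k.hi < ω⁻¹ k.lo) (hl : ω⁻¹ l.hi < ω⁻¹ l.lo) :
    ∃ z, wordPerm (l :: z) = simple k * ω ∧ wordPerm (k :: z) = simple l * ω ∧
      Reduced (l :: z) ∧ Reduced (k :: z) := by
  have hlk : l.lo ≠ k.lo ∧ l.lo ≠ k.hi ∧ l.hi ≠ k.lo ∧ l.hi ≠ k.hi := by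
    simp only [Crossing.lo, Crossing.hi, ne_eq, Fin.ext_iff]; omega
  obtain ⟨h1, h2, h3, h4⟩ := hlk
  obtain ⟨z, hz, hr⟩ := exists_reduced_word (simple l * (simple k * ω))
  refine ⟨z, by rw [wordPerm_cons, hz, simple_mul_cancel], ?_, hr.cons ?_, hr.cons ?_⟩
  · rw [wordPerm_cons, hz, ← mul_assoc (simple l), ← simple_comm h, mul_assoc, simple_mul_cancel]
  · simpa [hz, simple_of_ne k h1 h2, simple_of_ne k h3 h4] using hl
  · simpa [hz, simple_of_ne l h1.symm h3.symm, simple_of_ne l h2.symm h4.symm] using hk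

/-- With adjacent descents k and l the preimages of three consecutive values are decreasing, so the
full braid s_k s_l s_k splits off ω on the left; `z` spells the rest. -/
theorem exists_braid_word {k l : Crossing n} (h : l.1 = k.1 + 1) (ω : Equiv.Perm (Fin n))
    (hk : ω⁻¹ k.hi < ω⁻¹ k.lo) (hl : ω⁻¹ l.hi < ω⁻¹ l.lo) :
    ∃ z, wordPerm (l :: k :: z) = simple k * ω ∧ wordPerm (k :: l :: z) = simple l * ω ∧
      Reduced (l :: k :: z) ∧ Reduced (k :: l :: z) := by
  have e1 := lo_eq_hi_of_adjacent h
  have a1 := simple_left_hi h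
  have a2 := simple_right_lo h
  have a3 := simple_right_mid h
  have a4 : simple k l.lo = k.lo := by rw [e1, simple_hi]
  rw [e1] at hl
  obtain ⟨z, hz, hr⟩ := exists_reduced_word (simple k * (simple l * (simple k * ω)))
  have hz' : wordPerm z = simple l * (simple k * (simple l * ω)) := by
    rw [hz]; simp only [← mul_assoc, simple_braid h]
  refine ⟨z, ?_, ?_, (hr.cons ?_).cons ?_, (hr.cons ?_).cons ?_⟩
  · rw [wordPerm_cons, wordPerm_cons, hz, simple_mul_cancel, simple_mul_cancel]
  · rw [wordPerm_cons, wordPerm_cons, hz', simple_mul_cancel, simple_mul_cancel]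
  · simpa [hz, a1, a2, a3] using hl
  · rw [wordPerm_cons, hz, simple_mul_cancel]
    simpa [a1, a4] using hl.trans hk
  · simpa [hz', a2, a3, a1, e1] using hk
  · rw [wordPerm_cons, hz', simple_mul_cancel]
    simpa [a2, a3] using hl.trans hk

/-- Any two reduced words of a permutation are related by braid moves. -/
theorem braidEq_of_reduced {u v : List (Crossing n)} (hu : Reduced u) (hv : Reduced v)
    (h : wordPerm u = wordPerm v) : BraidEq u v := by
  induction hd : u.length using Nat.strong_induction_on generalizing u v with
  | _ d ih =>
    have hlen : u.length = v.length := by rw [hu, hv, h]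
    rcases u with _ | ⟨a, u⟩
    · rw [List.eq_nil_of_length_eq_zero hlen.symm]
      exact BraidEq.refl _
    rcases v with _ | ⟨b, v⟩
    · simp at hlen
    rw [List.length_cons] at hd
    rw [List.length_cons, List.length_cons] at hlen
    have descent : ∀ {c : Crossing n} {w : List (Crossing n)}, Reduced (c :: w) →
        (wordPerm (c :: w))⁻¹ c.hi < (wordPerm (c :: w))⁻¹ c.lo := by
      intro c w hw
      simpa [wordPerm_cons] using hw.lt_of_cons
    have da := descent hu
    have db := descent hv
    rw [← h] at db
    have pa : simple a * wordPerm (a :: u) = wordPerm u := by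
      rw [wordPerm_cons, simple_mul_cancel]
    have pb : simple b * wordPerm (a :: u) = wordPerm v := by
      rw [h, wordPerm_cons, simple_mul_cancel]
    -- The tails `u`, `v` are shorter, so by induction they may be replaced by tails `x`, `y` for
    -- which the two words differ by one braid move.
    have key : ∀ {x y : List (Crossing n)}, wordPerm x = wordPerm u → wordPerm y = wordPerm v →
        Reduced x → Reduced y → BraidEq (a :: x) (b :: y) → BraidEq (a :: u) (b :: v) := by
      intro x y hx hy rx ry hxy
      refine ((ih u.length (by omega) hu.tail rx hx.symm rfl).cons a).trans (hxy.trans ?_)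
      exact (ih v.length (by omega) hv.tail ry hy.symm rfl).symm.cons b
    rcases lt_trichotomy a.1 b.1 with hab | hab | hab
    · rcases Nat.lt_or_ge (a.1 + 1) b.1 with hab' | hab'
      · obtain ⟨z, z1, z2, z3, z4⟩ := exists_comm_word hab' _ da db
        exact key (z1.trans pa) (z2.trans pb) z3 z4 (BraidEq.comm z hab')
      · have e : b.1 = a.1 + 1 := by omega
        obtain ⟨z, z1, z2, z3, z4⟩ := exists_braid_word e _ da db
        exact key (z1.trans pa) (z2.trans pb) z3 z4 (BraidEq.braid z e)
    · obtain rfl : a = b := Subtype.ext hab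
      rw [wordPerm_cons, wordPerm_cons] at h
      exact (ih u.length (by omega) hu.tail hv.tail (mul_left_cancel h) rfl).cons a
    · rcases Nat.lt_or_ge (b.1 + 1) a.1 with hab' | hab'
      · obtain ⟨z, z1, z2, z3, z4⟩ := exists_comm_word hab' _ db da
        exact key (z2.trans pa) (z1.trans pb) z4 z3 (BraidEq.comm z hab').symm
      · have e : a.1 = b.1 + 1 := by omega
        obtain ⟨z, z1, z2, z3, z4⟩ := exists_braid_word e _ db da
        exact key (z2.trans pa) (z1.trans pb) z4 z3 (BraidEq.braid z e).symm

/-- If `k` cannot be prepended to a reduced word, that word can be made to start with `k`. -/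
theorem exists_cons_braidEq {k : Crossing n} {u : List (Crossing n)} (hu : Reduced u)
    (h : ¬ Reduced (k :: u)) : ∃ z, BraidEq u (k :: z) := by
  have hk : (wordPerm u)⁻¹ k.hi < (wordPerm u)⁻¹ k.lo := by
    by_contra hc
    exact h (hu.cons (lt_of_le_of_ne (not_lt.mp hc)
      fun g => k.lo_ne_hi ((wordPerm u)⁻¹.injective g)))
  obtain ⟨z, hz, hr⟩ := exists_reduced_word (simple k * wordPerm u)
  refine ⟨z, braidEq_of_reduced hu (hr.cons ?_) ?_⟩
  · simpa [hz] using hk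
  · rw [wordPerm_cons, hz, simple_mul_cancel]

end Words

/-! ### Spanning: the length filtration of R(ν)1_i. -/

section Algebra

variable {I : Type u}

theorem Seq.perm_perm {ν : I →₀ ℕ} (i : Seq ν) (σ τ : Equiv.Perm (Fin (ht ν))) :
    (i.perm σ).perm τ = i.perm (τ * σ) := rfl

theorem Seq.perm_one {ν : I →₀ ℕ} (i : Seq ν) : i.perm 1 = i := rfl

theorem Seq.perm_at {ν : I →₀ ℕ} (i : Seq ν) (σ : Equiv.Perm (Fin (ht ν))) (k : Fin (ht ν)) :
    (i.perm σ).at k = i.at (σ⁻¹ k) := rfl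

theorem Seq.sw_sw {ν : I →₀ ℕ} (i : Seq ν) (k : Crossing (ht ν)) : (i.sw k).sw k = i := by
  rw [Seq.sw, Seq.sw, Seq.perm_perm, simple_mul_self, Seq.perm_one]

theorem Seq.perm_wordPerm_cons {ν : I →₀ ℕ} (i : Seq ν) (k : Crossing (ht ν))
    (w : List (Crossing (ht ν))) : i.perm (wordPerm (k :: w)) = (i.perm (wordPerm w)).sw k := by
  rw [Seq.sw, Seq.perm_perm, wordPerm_cons]

variable {K : Type v} [Field K] [Fintype I] [DecidableEq I] {D : BorcherdsCartanDatum I}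
  {ν : I →₀ ℕ}

theorem mk_eq_of_rel {a b : FreeAlgebra K (Gen ν)} (h : Rel K D ν a b) :
    RingQuot.mkAlgHom K (Rel K D ν) a = RingQuot.mkAlgHom K (Rel K D ν) b :=
  RingQuot.mkAlgHom_rel K h

theorem e_mul_e (i : Seq ν) : e K D i * e K D i = e K D i :=
  (map_mul _ _ _).symm.trans (mk_eq_of_rel (Rel.idem_idem (K := K) (D := D) i))

theorem e_mul_e_of_ne {i j : Seq ν} (h : i ≠ j) : e K D i * e K D j = 0 :=
  (map_mul _ _ _).symm.trans
    ((mk_eq_of_rel (Rel.idem_ne (K := K) (D := D) i j h)).trans (map_zero _))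

theorem sum_e : ∑ i : Seq ν, e K D i = 1 :=
  (map_sum _ _ _).symm.trans
    ((mk_eq_of_rel (Rel.idem_sum (K := K) (D := D) (ν := ν))).trans (map_one _))

theorem e_mul_x (k : Fin (ht ν)) (i : Seq ν) : e K D i * x K D k i = x K D k i :=
  (map_mul _ _ _).symm.trans (mk_eq_of_rel (Rel.idem_dot (K := K) (D := D) k i))

theorem x_mul_e (k : Fin (ht ν)) (i : Seq ν) : x K D k i * e K D i = x K D k i :=
  (map_mul _ _ _).symm.trans (mk_eq_of_rel (Rel.dot_idem (K := K) (D := D) k i))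

theorem e_mul_t (k : Crossing (ht ν)) (i : Seq ν) : e K D (i.sw k) * t K D k i = t K D k i :=
  (map_mul _ _ _).symm.trans (mk_eq_of_rel (Rel.idem_cross (K := K) (D := D) k i))

theorem t_mul_e (k : Crossing (ht ν)) (i : Seq ν) : t K D k i * e K D i = t K D k i :=
  (map_mul _ _ _).symm.trans (mk_eq_of_rel (Rel.cross_idem (K := K) (D := D) k i))

theorem x_mul_x (k l : Fin (ht ν)) (i : Seq ν) :
    x K D k i * x K D l i = x K D l i * x K D k i :=
  (map_mul _ _ _).symm.trans ((mk_eq_of_rel (Rel.dot_dot (K := K) (D := D) k l i)).trans (map_mul _ _ _))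

theorem t_mul_t_comm {k l : Crossing (ht ν)} (h : k.1 + 1 < l.1) (i : Seq ν) :
    t K D k (i.sw l) * t K D l i = t K D l (i.sw k) * t K D k i :=
  (map_mul _ _ _).symm.trans ((mk_eq_of_rel (Rel.cross_cross (K := K) (D := D) k l i h)).trans (map_mul _ _ _))

/-- The value of the scalar (1, -1 or 0) is irrelevant for spanning: what counts is that the error
term has lost its crossing. -/
theorem exists_x_mul_t (k : Crossing (ht ν)) (l : Fin (ht ν)) (i : Seq ν) :
    ∃ c : K, x K D l (i.sw k) * t K D k i = t K D k i * x K D (simple k l) i + c • e K D i := by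
  by_cases h1 : l = k.lo
  · subst h1
    by_cases h : i.at k.lo = i.at k.hi ∧ D.IsReal (i.at k.lo)
    · refine ⟨1, ?_⟩
      have := mk_eq_of_rel (Rel.slide_real (K := K) (D := D) k i h.1 h.2)
      rw [map_sub, map_mul, map_mul, sub_eq_iff_eq_add'] at this
      rw [simple_lo, one_smul]
      exact this
    · refine ⟨0, ?_⟩
      have := mk_eq_of_rel (Rel.slide_other (K := K) (D := D) k i h)
      rw [map_mul, map_mul] at this
      rw [simple_lo, zero_smul, add_zero]
      exact this
  by_cases h2 : l = k.hi
  · subst h2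
    by_cases h : i.at k.lo = i.at k.hi ∧ D.IsReal (i.at k.lo)
    · refine ⟨-1, ?_⟩
      have := mk_eq_of_rel (Rel.slide_real' (K := K) (D := D) k i h.1 h.2)
      rw [map_sub, map_mul, map_mul] at this
      rw [simple_hi, neg_one_smul K (e K D i), ← sub_eq_add_neg, eq_sub_iff_add_eq, ← eq_sub_iff_add_eq']
      exact this.symm
    · refine ⟨0, ?_⟩
      have := mk_eq_of_rel (Rel.slide_other' (K := K) (D := D) k i h)
      rw [map_mul, map_mul] at this
      rw [simple_hi, zero_smul, add_zero]
      exact this.symm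
  · refine ⟨0, ?_⟩
    have := mk_eq_of_rel (Rel.dot_cross (K := K) (D := D) k l i h1 h2)
    rw [map_mul, map_mul] at this
    rw [simple_of_ne k h1 h2, zero_smul, add_zero]
    exact this

open scoped IsMulCommutative in
variable (K D) in
/-- The homomorphism `K[x_1, …, x_n] → R(ν)` sending `x_k` to `x_{k,i}`. -/
noncomputable def phi (i : Seq ν) : MvPolynomial (Fin (ht ν)) K →ₐ[K] R K D ν :=
  -- Evaluation of polynomials needs a commutative target, hence the detour through the subalgebra
  -- generated by the dots. The map is unital for R(ν), so 1 goes to 1 and not to 1_i; this is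
  -- harmless to the right of a `tWord`, which absorbs 1_i.
  haveI : IsMulCommutative (Algebra.adjoin K (Set.range fun k => x K D k i)) :=
    Algebra.isMulCommutative_adjoin K (by
      rintro _ ⟨k, rfl⟩ _ ⟨l, rfl⟩
      exact x_mul_x k l i)
  (Algebra.adjoin K (Set.range fun k => x K D k i)).val.comp
    (MvPolynomial.aeval fun k => ⟨x K D k i, Algebra.subset_adjoin ⟨k, rfl⟩⟩)

theorem phi_X (i : Seq ν) (k : Fin (ht ν)) : phi K D i (MvPolynomial.X k) = x K D k i := by
  simp [phi]

theorem phi_monomial (i : Seq ν) (m : Fin (ht ν) →₀ ℕ) (c : K) :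
    phi K D i (MvPolynomial.monomial m c) = c • xMonomial K D m i := by
  have h : MvPolynomial.monomial m c =
      c • (List.ofFn fun k => (MvPolynomial.X k : MvPolynomial (Fin (ht ν)) K) ^ m k).prod := by
    rw [List.prod_ofFn, MvPolynomial.monomial_eq, Finsupp.prod_fintype _ _ (fun _ => pow_zero _),
      MvPolynomial.smul_eq_C_mul]
  rw [h, map_smul, map_list_prod, List.map_ofFn]
  simp only [Function.comp_def, map_pow, phi_X, xMonomial]

variable (K D) in
/-- The span of the elements `τ_w p(x)` of `R(ν) 1_i` with `w` a word of length less than `d`. -/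
noncomputable def wordSpan (i : Seq ν) (d : ℕ) : Submodule K (R K D ν) :=
  Submodule.span K {z | ∃ w p, w.length < d ∧ z = tWord K D w i * phi K D i p}

theorem wordSpan_mono (i : Seq ν) {d d' : ℕ} (h : d ≤ d') :
    wordSpan K D i d ≤ wordSpan K D i d' :=
  Submodule.span_mono fun _ ⟨w, p, hw, hz⟩ => ⟨w, p, hw.trans_le h, hz⟩

theorem mem_wordSpan (i : Seq ν) {w : List (Crossing (ht ν))} {d : ℕ} (h : w.length < d)
    (p : MvPolynomial (Fin (ht ν)) K) : tWord K D w i * phi K D i p ∈ wordSpan K D i d :=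
  Submodule.subset_span ⟨w, p, h, rfl⟩

theorem tWord_mem_wordSpan (i : Seq ν) {w : List (Crossing (ht ν))} {d : ℕ} (h : w.length < d) :
    tWord K D w i ∈ wordSpan K D i d := by
  simpa using mem_wordSpan (K := K) (D := D) i h 1

/-- A linear map sends `wordSpan` to a submodule if it does so for the spanning elements. -/
theorem wordSpan_induction {i : Seq ν} {d : ℕ} (f : R K D ν →ₗ[K] R K D ν)
    {S : Submodule K (R K D ν)}
    (h : ∀ w p, w.length < d → f (tWord K D w i * phi K D i p) ∈ S) {z : R K D ν}
    (hz : z ∈ wordSpan K D i d) : f z ∈ S := by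
  have : wordSpan K D i d ≤ S.comap f := by
    refine Submodule.span_le.2 ?_
    rintro _ ⟨w, p, hw, rfl⟩
    exact h w p hw
  exact this hz

theorem mul_phi_mem {i : Seq ν} {d : ℕ} {z : R K D ν} (hz : z ∈ wordSpan K D i d)
    (q : MvPolynomial (Fin (ht ν)) K) : z * phi K D i q ∈ wordSpan K D i d := by
  refine wordSpan_induction (LinearMap.mulRight K (phi K D i q)) (fun w p hw => ?_) hz
  rw [LinearMap.mulRight_apply, mul_assoc, ← map_mul]
  exact mem_wordSpan i hw _

theorem e_mul_tWord (w : List (Crossing (ht ν))) (i : Seq ν) :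
    e K D (i.perm (wordPerm w)) * tWord K D w i = tWord K D w i := by
  cases w with
  | nil => exact e_mul_e i
  | cons k w => rw [tWord, Seq.perm_wordPerm_cons, ← mul_assoc, e_mul_t]

theorem tWord_mul_e (w : List (Crossing (ht ν))) (i : Seq ν) :
    tWord K D w i * e K D i = tWord K D w i := by
  induction w with
  | nil => exact e_mul_e i
  | cons k w ih => rw [tWord, mul_assoc, ih]

theorem mul_tWord_of_ne {z : R K D ν} {j : Seq ν} (hz : z * e K D j = z)
    {w : List (Crossing (ht ν))} {i : Seq ν} (h : j ≠ i.perm (wordPerm w)) :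
    z * tWord K D w i = 0 := by
  rw [← hz, ← e_mul_tWord, mul_assoc, ← mul_assoc (e K D j), e_mul_e_of_ne h, zero_mul, mul_zero]

theorem e_mul_mem {i : Seq ν} {d : ℕ} {z : R K D ν} (hz : z ∈ wordSpan K D i d) (j : Seq ν) :
    e K D j * z ∈ wordSpan K D i d := by
  refine wordSpan_induction (LinearMap.mulLeft K (e K D j)) (fun w p hw => ?_) hz
  rw [LinearMap.mulLeft_apply, ← mul_assoc]
  by_cases h : j = i.perm (wordPerm w)
  · rw [h, e_mul_tWord]
    exact mem_wordSpan i hw _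
  · rw [mul_tWord_of_ne (e_mul_e j) h, zero_mul]
    exact zero_mem _

theorem t_mul_mem {i : Seq ν} {d : ℕ} {z : R K D ν} (hz : z ∈ wordSpan K D i d)
    (k : Crossing (ht ν)) (j : Seq ν) : t K D k j * z ∈ wordSpan K D i (d + 1) := by
  refine wordSpan_induction (LinearMap.mulLeft K (t K D k j)) (fun w p hw => ?_) hz
  rw [LinearMap.mulLeft_apply, ← mul_assoc]
  by_cases h : j = i.perm (wordPerm w)
  · rw [h]
    exact mem_wordSpan i (w := k :: w) (Nat.succ_lt_succ hw) _
  · rw [mul_tWord_of_ne (t_mul_e k j) h, zero_mul]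
    exact zero_mem _

/-- Follow the dot down its strand: each crossing passed contributes at most a scalar times the word
with that letter deleted. -/
theorem x_mul_tWord_sub_mem (w : List (Crossing (ht ν))) (i : Seq ν) (l : Fin (ht ν)) :
    x K D l (i.perm (wordPerm w)) * tWord K D w i
      - tWord K D w i * x K D ((wordPerm w)⁻¹ l) i ∈ wordSpan K D i w.length := by
  induction w generalizing l with
  | nil =>
    have : x K D l (i.perm (wordPerm [])) * tWord K D [] i
        - tWord K D [] i * x K D ((wordPerm [])⁻¹ l) i = 0 := by
      rw [wordPerm_nil, inv_one, Seq.perm_one, tWord, x_mul_e, Equiv.Perm.one_apply, e_mul_x,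
        sub_self]
    rw [this]
    exact zero_mem _
  | cons k w ih =>
    obtain ⟨c, hc⟩ := exists_x_mul_t (K := K) (D := D) k l (i.perm (wordPerm w))
    rw [Seq.perm_wordPerm_cons, tWord, ← mul_assoc, hc, wordPerm_cons, mul_inv_rev, simple_inv,
      Equiv.Perm.mul_apply, add_mul, smul_mul_assoc, e_mul_tWord, add_sub_right_comm, mul_assoc,
      mul_assoc, ← mul_sub]
    exact add_mem (t_mul_mem (ih _) k _)
      (Submodule.smul_mem _ _ (tWord_mem_wordSpan i (Nat.lt_succ_self _)))

theorem x_mul_mem {i : Seq ν} {d : ℕ} {z : R K D ν} (hz : z ∈ wordSpan K D i d)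
    (l : Fin (ht ν)) (j : Seq ν) : x K D l j * z ∈ wordSpan K D i d := by
  refine wordSpan_induction (LinearMap.mulLeft K (x K D l j)) (fun w p hw => ?_) hz
  rw [LinearMap.mulLeft_apply, ← mul_assoc]
  by_cases h : j = i.perm (wordPerm w)
  · subst h
    refine mul_phi_mem ?_ p
    rw [← sub_add_cancel (x K D l (i.perm (wordPerm w)) * tWord K D w i)
      (tWord K D w i * x K D ((wordPerm w)⁻¹ l) i)]
    refine add_mem (wordSpan_mono i hw.le (x_mul_tWord_sub_mem w i l)) ?_
    rw [← phi_X]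
    exact mem_wordSpan i hw _
  · rw [mul_tWord_of_ne (x_mul_e l j) h, zero_mul]
    exact zero_mem _

theorem x_pow_mul_mem {i : Seq ν} {d : ℕ} {z : R K D ν} (hz : z ∈ wordSpan K D i d)
    (l : Fin (ht ν)) (j : Seq ν) (m : ℕ) : x K D l j ^ m * z ∈ wordSpan K D i d := by
  induction m with
  | zero => simpa using hz
  | succ m ih =>
    rw [pow_succ', mul_assoc]
    exact x_mul_mem ih l j

/-- The square of a crossing is a polynomial in idempotents and dots, none of which raises the
length. -/
theorem t_mul_t_mul_mem {i : Seq ν} {d : ℕ} {z : R K D ν} (hz : z ∈ wordSpan K D i d)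
    (k : Crossing (ht ν)) (j : Seq ν) :
    t K D k (j.sw k) * (t K D k j * z) ∈ wordSpan K D i d := by
  rw [← mul_assoc]
  by_cases h : j.at k.lo = j.at k.hi
  · have := mk_eq_of_rel (Rel.double_same (K := K) (D := D) k j h)
    rw [map_mul, map_zero] at this
    have h' : t K D k (j.sw k) * t K D k j = 0 := this
    rw [h', zero_mul]
    exact zero_mem _
  by_cases h0 : D.form (j.at k.lo) (j.at k.hi) = 0
  · have := mk_eq_of_rel (Rel.double_orth (K := K) (D := D) k j h h0)
    rw [map_mul] at this
    have h' : t K D k (j.sw k) * t K D k j = e K D j := this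
    rw [h']
    exact e_mul_mem hz j
  · have := mk_eq_of_rel (Rel.double_edge (K := K) (D := D) k j h h0)
    rw [map_mul, map_add, map_pow, map_pow] at this
    have h' : t K D k (j.sw k) * t K D k j = x K D k.lo j ^ D.negA (j.at k.lo) (j.at k.hi)
        + x K D k.hi j ^ D.negA (j.at k.hi) (j.at k.lo) := this
    rw [h', add_mul]
    exact add_mem (x_pow_mul_mem hz _ _ _) (x_pow_mul_mem hz _ _ _)

/-- The defect of the braid relation contains only dots, so the three crossings disappear from the
bound. -/
theorem braid_mul_mem {i : Seq ν} {d : ℕ} {z : R K D ν} (hz : z ∈ wordSpan K D i d)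
    {k l : Crossing (ht ν)} (h : l.1 = k.1 + 1) (j : Seq ν) :
    t K D k ((j.sw k).sw l) * (t K D l (j.sw k) * (t K D k j * z))
      - t K D l ((j.sw l).sw k) * (t K D k (j.sw l) * (t K D l j * z)) ∈ wordSpan K D i d := by
  simp only [← mul_assoc]
  rw [← sub_mul]
  by_cases h1 : j.at k.lo = j.at l.hi ∧ j.at k.lo ≠ j.at l.lo ∧ D.IsReal (j.at k.lo) ∧
        D.form (j.at k.lo) (j.at l.lo) ≠ 0
  · have := mk_eq_of_rel
      (Rel.braid_edge (K := K) (D := D) k l j h h1.1 h1.2.1 h1.2.2.1 h1.2.2.2)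
    simp only [map_sub, map_mul, map_sum, map_pow] at this
    have h' : t K D k ((j.sw k).sw l) * t K D l (j.sw k) * t K D k j
      - t K D l ((j.sw l).sw k) * t K D k (j.sw l) * t K D l j =
        ∑ c ∈ Finset.range (D.negA (j.at k.lo) (j.at l.lo)), x K D k.lo j ^ c *
          x K D l.hi j ^ (D.negA (j.at k.lo) (j.at l.lo) - 1 - c) * e K D j := this
    rw [h', Finset.sum_mul]
    refine sum_mem fun c _ => ?_
    rw [mul_assoc, mul_assoc]
    exact x_pow_mul_mem (x_pow_mul_mem (e_mul_mem hz j) _ _ _) _ _ _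
  · have := mk_eq_of_rel (Rel.braid_other (K := K) (D := D) k l j h h1)
    simp only [map_mul] at this
    have h' : t K D k ((j.sw k).sw l) * t K D l (j.sw k) * t K D k j
      = t K D l ((j.sw l).sw k) * t K D k (j.sw l) * t K D l j := this
    rw [h', sub_self, zero_mul]
    exact zero_mem _

/-- Distant crossings commute exactly; a braid move costs terms with three letters fewer. As braid
moves preserve length, one bound serves a whole chain of moves. -/
theorem BraidEq.tWord_sub_mem {u w : List (Crossing (ht ν))} (h : BraidEq u w) (i : Seq ν) :
    tWord K D u i - tWord K D w i ∈ wordSpan K D i u.length := by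
  induction h with
  | refl => rw [sub_self]; exact zero_mem _
  | symm h ih => rw [← h.length_eq, ← neg_sub]; exact neg_mem ih
  | trans h _ ih ih' =>
    rw [← h.length_eq] at ih'
    simpa using add_mem ih ih'
  | cons k h ih =>
    rw [tWord, tWord, h.wordPerm_eq, ← mul_sub]
    exact t_mul_mem ih k _
  | comm w h =>
    simp only [tWord, Seq.perm_wordPerm_cons]
    rw [← mul_assoc, ← mul_assoc, t_mul_t_comm h, sub_self]
    exact zero_mem _
  | braid w h =>
    simp only [tWord, Seq.perm_wordPerm_cons]
    exact wordSpan_mono i (by simp) (braid_mul_mem (tWord_mem_wordSpan i (Nat.lt_succ_self _)) h _)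

/-- Peel off letters until the tail `u` is reduced but `k :: u` is not. By exchange, `u` becomes `k
:: z` modulo shorter words, and then τ_k meets τ_k. -/
theorem tWord_mem_of_not_reduced {w : List (Crossing (ht ν))} (h : ¬ Reduced w) (i : Seq ν) :
    tWord K D w i ∈ wordSpan K D i w.length := by
  induction w with
  | nil => exact absurd (inv_perm_one _).symm h
  | cons k u ih =>
    by_cases hu : Reduced u
    · obtain ⟨z, hz⟩ := exists_cons_braidEq hu h
      rw [tWord, ← sub_add_cancel (tWord K D u i) (tWord K D (k :: z) i), mul_add]
      refine add_mem (t_mul_mem (hz.tWord_sub_mem i) k _) ?_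
      rw [tWord, hz.wordPerm_eq, Seq.perm_wordPerm_cons]
      refine t_mul_t_mul_mem (tWord_mem_wordSpan i ?_) k _
      rw [List.length_cons, hz.length_eq, List.length_cons]
      omega
    · exact t_mul_mem (ih hu) k _

/-- The union of the filtration is stable under left multiplication by the generators, hence by
R(ν). Applied to 1_i it gives all of R(ν)1_i. -/
theorem exists_mem_wordSpan (r : R K D ν) {i : Seq ν} {z : R K D ν}
    (hz : ∃ d, z ∈ wordSpan K D i d) : ∃ d, r * z ∈ wordSpan K D i d := by
  obtain ⟨a, rfl⟩ := RingQuot.mkAlgHom_surjective K (Rel K D ν) r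
  induction a using FreeAlgebra.induction generalizing z with
  | grade0 c =>
    obtain ⟨d, hd⟩ := hz
    refine ⟨d, ?_⟩
    rw [AlgHom.commutes, ← Algebra.smul_def]
    exact Submodule.smul_mem _ _ hd
  | grade1 g =>
    obtain ⟨d, hd⟩ := hz
    cases g with
    | idem j => exact ⟨d, e_mul_mem hd j⟩
    | dot k j => exact ⟨d, x_mul_mem hd k j⟩
    | cross k j => exact ⟨d + 1, t_mul_mem hd k j⟩
  | mul a b ha hb =>
    rw [map_mul, mul_assoc]
    exact ha (hb hz)
  | add a b ha hb =>
    obtain ⟨d, hd⟩ := ha hz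
    obtain ⟨d', hd'⟩ := hb hz
    refine ⟨max d d', ?_⟩
    rw [map_add, add_mul]
    exact add_mem (wordSpan_mono i (le_max_left _ _) hd) (wordSpan_mono i (le_max_right _ _) hd')

/-- Modulo shorter words, a word of top length either vanishes (if not reduced) or equals the chosen
expression of its permutation. -/
theorem wordSpan_le_span {red : Equiv.Perm (Fin (ht ν)) → List (Crossing (ht ν))}
    (hred : ∀ ω, IsReducedExpr (red ω) ω) (i : Seq ν) (d : ℕ) :
    wordSpan K D i d ≤ Submodule.span K
      (Set.range fun p : Equiv.Perm (Fin (ht ν)) × (Fin (ht ν) → ℕ) =>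
        tWord K D (red p.1) i * xMonomial K D p.2 i) := by
  induction d with
  | zero =>
    refine Submodule.span_le.2 ?_
    rintro _ ⟨w, p, hw, -⟩
    exact absurd hw (Nat.not_lt_zero _)
  | succ d ih =>
    refine Submodule.span_le.2 ?_
    rintro _ ⟨w, p, hw, rfl⟩
    rcases (Nat.lt_succ_iff.1 hw).lt_or_eq with hlt | rfl
    · exact ih (mem_wordSpan i hlt p)
    by_cases hr : Reduced w
    · have h := (isReducedExpr_iff _ _).1 (hred (wordPerm w))
      have hb : BraidEq w (red (wordPerm w)) :=
        braidEq_of_reduced hr (by rw [Reduced, h.1, h.2]) h.1.symm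
      rw [← sub_add_cancel (tWord K D w i) (tWord K D (red (wordPerm w)) i), add_mul]
      refine add_mem (ih (mul_phi_mem (hb.tWord_sub_mem i) p)) ?_
      induction p using MvPolynomial.induction_on' with
      | monomial m c =>
        rw [phi_monomial, mul_smul_comm]
        exact Submodule.smul_mem _ _ (Submodule.subset_span ⟨(wordPerm w, m), rfl⟩)
      | add p q hp hq =>
        rw [map_add, mul_add]
        exact add_mem hp hq
    · exact ih (mul_phi_mem (tWord_mem_of_not_reduced hr i) p)

theorem x_mul_e_comm (k : Fin (ht ν)) (i : Seq ν) : x K D k i * e K D i = e K D i * x K D k i := by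
  rw [x_mul_e, e_mul_x]

theorem xMonomial_mul_e (m : Fin (ht ν) → ℕ) (i : Seq ν) :
    xMonomial K D m i * e K D i = e K D i * xMonomial K D m i := by
  refine Commute.list_prod_left _ _ fun z hz => ?_
  obtain ⟨k, rfl⟩ := (List.mem_ofFn' _ _).1 hz
  exact Commute.pow_left (x_mul_e_comm k i) _

theorem tWord_mul_xMonomial_mul_e (w : List (Crossing (ht ν))) (m : Fin (ht ν) → ℕ) (i : Seq ν) :
    tWord K D w i * xMonomial K D m i * e K D i = tWord K D w i * xMonomial K D m i := by
  rw [mul_assoc, xMonomial_mul_e, ← mul_assoc, tWord_mul_e]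

theorem mem_component {i j : Seq ν} {z : R K D ν} :
    z ∈ component K D j i ↔ e K D j * z = z ∧ z * e K D i = z := by
  constructor
  · rintro ⟨y, rfl⟩
    simp only [LinearMap.comp_apply, LinearMap.mulLeft_apply, LinearMap.mulRight_apply]
    exact ⟨by rw [← mul_assoc, e_mul_e], by rw [mul_assoc, mul_assoc, e_mul_e]⟩
  · rintro ⟨h1, h2⟩
    exact ⟨z, by simp [h1, h2]⟩

theorem span_eq_component {i j : Seq ν}
    {red : {ω : Equiv.Perm (Fin (ht ν)) // i.perm ω = j} → List (Crossing (ht ν))}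
    (hred : ∀ ω, IsReducedExpr (red ω) ω.1) :
    Submodule.span K (Set.range
      fun p : {ω : Equiv.Perm (Fin (ht ν)) // i.perm ω = j} × (Fin (ht ν) → ℕ) =>
        tWord K D (red p.1) i * xMonomial K D p.2 i) = component K D j i := by
  classical
  apply le_antisymm
  · refine Submodule.span_le.2 ?_
    rintro _ ⟨⟨ω, m⟩, rfl⟩
    refine mem_component.2 ⟨?_, tWord_mul_xMonomial_mul_e _ _ _⟩
    have h := e_mul_tWord (K := K) (D := D) (red ω) i
    rw [(hred ω).1, ω.2] at h
    rw [← mul_assoc, h]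
  · intro z hz
    obtain ⟨h1, h2⟩ := mem_component.1 hz
    choose red0 hred0 using fun ω : Equiv.Perm (Fin (ht ν)) => exists_reduced ω
    -- The filtration argument concerns all of R(ν)1_i, so expressions are needed also for ω with
    -- ω(i) ≠ j. Their choice does not matter: multiplication by 1_j kills those terms.
    let red' : Equiv.Perm (Fin (ht ν)) → List (Crossing (ht ν)) := fun ω =>
      if h : i.perm ω = j then red ⟨ω, h⟩ else red0 ω
    have hred' : ∀ ω, IsReducedExpr (red' ω) ω := by
      intro ω
      by_cases h : i.perm ω = j
      · simpa only [red', dif_pos h] using hred ⟨ω, h⟩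
      · simpa only [red', dif_neg h] using (isReducedExpr_iff _ _).2 (hred0 ω)
    obtain ⟨d, hd⟩ := exists_mem_wordSpan z
      ⟨1, tWord_mem_wordSpan (K := K) (D := D) i (w := []) Nat.zero_lt_one⟩
    rw [tWord, h2] at hd
    have key : Submodule.span K
        (Set.range fun p : Equiv.Perm (Fin (ht ν)) × (Fin (ht ν) → ℕ) =>
          tWord K D (red' p.1) i * xMonomial K D p.2 i) ≤ (Submodule.span K (Set.range
      fun p : {ω : Equiv.Perm (Fin (ht ν)) // i.perm ω = j} × (Fin (ht ν) → ℕ) =>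
        tWord K D (red p.1) i * xMonomial K D p.2 i)).comap (LinearMap.mulLeft K (e K D j)) := by
      refine Submodule.span_le.2 ?_
      rintro _ ⟨⟨ω, m⟩, rfl⟩
      rw [SetLike.mem_coe, Submodule.mem_comap, LinearMap.mulLeft_apply]
      rw [← mul_assoc]
      by_cases h : i.perm ω = j
      · have h' := e_mul_tWord (K := K) (D := D) (red' ω) i
        rw [(hred' ω).1, h] at h'
        rw [h']
        refine Submodule.subset_span ⟨(⟨ω, h⟩, m), ?_⟩
        simp only [red', dif_pos h]
      · rw [mul_tWord_of_ne (e_mul_e j) (by rw [(hred' ω).1]; exact fun g => h g.symm), zero_mul]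
        exact zero_mem _
    have := key (wordSpan_le_span hred' i d hd)
    rwa [Submodule.mem_comap, LinearMap.mulLeft_apply, h1] at this

end Algebra

theorem BorcherdsCartanDatum.form_comm {I : Type u} (D : BorcherdsCartanDatum I) (i j : I) :
    D.form i j = D.form j i := D.symm i j

/-- Positivity of the exponents keeps the edge polynomials from degenerating, and makes powers of a
dot stay in one summand of 𝒫_ν. -/
theorem BorcherdsCartanDatum.negA_ne_zero {I : Type u} (D : BorcherdsCartanDatum I) {i j : I}
    (hij : i ≠ j) (h : D.form i j ≠ 0) : D.negA i j ≠ 0 := by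
  have h1 : D.a i j ≠ 0 := right_ne_zero_of_mul h
  have h2 := D.offDiag i j hij
  rw [BorcherdsCartanDatum.negA]
  omega

set_option linter.unusedSimpArgs false

/-! ### The defining relations as identities between swaps in a field. -/

section Swaps

/-- Commuting involutions `U` and `V` of a field that exchange, respectively, two elements `x`, `x'`
and two elements `y`, `y'`, and fix the other two. -/
structure SwapData (F : Type v) [Field F] where
  x : F
  x' : F
  y : F
  y' : F
  U : F →+* F
  V : F →+* F
  x_ne : x ≠ x'
  y_ne : y ≠ y'
  Ux : U x = x'
  Ux' : U x' = x
  Uy : U y = y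
  Uy' : U y' = y'
  Vx : V x = x
  Vx' : V x' = x'
  Vy : V y = y'
  Vy' : V y' = y
  UU : ∀ f, U (U f) = f
  VV : ∀ f, V (V f) = f
  VU : ∀ f, V (U f) = U (V f)

variable {F : Type v} [Field F]

/-- Swaps of disjoint pairs. -/
structure SwapData.Far (c d : SwapData F) : Prop where
  Ux : c.U d.x = d.x
  Ux' : c.U d.x' = d.x'
  Uy : c.U d.y = d.y
  Uy' : c.U d.y' = d.y'
  Vx : c.V d.x = d.x
  Vx' : c.V d.x' = d.x'
  Vy : c.V d.y = d.y
  Vy' : c.V d.y' = d.y'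
  xU : d.U c.x = c.x
  xU' : d.U c.x' = c.x'
  yU : d.U c.y = c.y
  yU' : d.U c.y' = c.y'
  xV : d.V c.x = c.x
  xV' : d.V c.x' = c.x'
  yV : d.V c.y = c.y
  yV' : d.V c.y' = c.y'
  UU : ∀ f, d.U (c.U f) = c.U (d.U f)
  UV : ∀ f, d.U (c.V f) = c.V (d.U f)
  VU : ∀ f, d.V (c.U f) = c.U (d.V f)
  VV : ∀ f, d.V (c.V f) = c.V (d.V f)

/-- Swaps of pairs with one element in common. -/
structure SwapData.Adj (c d : SwapData F) : Prop where
  x_eq : d.x = c.x'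
  y_eq : d.y = c.y'
  x_ne : c.x ≠ d.x'
  y_ne : c.y ≠ d.y'
  Ux' : c.U d.x' = d.x'
  Uy' : c.U d.y' = d.y'
  Vx' : c.V d.x' = d.x'
  Vy' : c.V d.y' = d.y'
  xU : d.U c.x = c.x
  yU : d.U c.y = c.y
  xV : d.V c.x = c.x
  yV : d.V c.y = c.y
  UV : ∀ f, c.V (d.U f) = d.U (c.V f)
  VU : ∀ f, d.V (c.U f) = c.U (d.V f)
  braidU : ∀ f, d.U (c.U (d.U f)) = c.U (d.U (c.U f))
  braidV : ∀ f, d.V (c.V (d.V f)) = c.V (d.V (c.V f))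

variable {I : Type u} {D : BorcherdsCartanDatum I} (O : D.Orientation)

open Classical in
/-- The polynomial factor of the crossing of strands with different labels `p` and `q`. -/
noncomputable def edgeFactor (p q : I) (x x' : F) : F :=
  if D.form p q = 0 then 1 else if O.arrow q p then 1
    else x ^ D.negA q p + x' ^ D.negA p q

open Classical in
/-- The action on a field of the crossing of strands labelled `p` and `q`. -/
noncomputable def fieldCross (p q : I) (c : SwapData F) (f : F) : F :=
  if p = q then
    if D.IsReal p then (f - c.U f) / (c.x - c.x') else (c.U f - c.U (c.V f)) / (c.y - c.y')
  else edgeFactor O p q c.x c.x' * c.U (c.V f)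

theorem map_edgeFactor (p q : I) (x x' : F) (φ : F →+* F) :
    φ (edgeFactor O p q x x') = edgeFactor O p q (φ x) (φ x') := by
  unfold edgeFactor
  split_ifs <;> simp

theorem edgeFactor_of_form_eq_zero {p q : I} (h : D.form p q = 0) (x x' : F) :
    edgeFactor O p q x x' = 1 := if_pos h

/-- Exactly one of the two directions carries the polynomial and the other carries 1, so the product
does not depend on the orientation. -/
theorem edgeFactor_mul_edgeFactor {p q : I} (hpq : p ≠ q) (h : D.form p q ≠ 0) (x x' : F) :
    edgeFactor O q p x x' * edgeFactor O p q x' x = x ^ D.negA p q + x' ^ D.negA q p := by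
  have h' : D.form q p ≠ 0 := by rwa [D.form_comm]
  unfold edgeFactor
  rw [if_neg h, if_neg h']
  by_cases ha : O.arrow p q
  · rw [if_pos ha, if_neg (O.not_both _ _ ha), one_mul, add_comm]
  · rw [if_neg ha, if_pos ((O.arrow_or p q hpq h).resolve_left ha), mul_one]

variable {O}

theorem fieldCross_real {p : I} (h : D.IsReal p) (c : SwapData F) (f : F) :
    fieldCross O p p c f = (f - c.U f) / (c.x - c.x') := by
  rw [fieldCross, if_pos rfl, if_pos h]

theorem fieldCross_imag {p : I} (h : ¬ D.IsReal p) (c : SwapData F) (f : F) :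
    fieldCross O p p c f = (c.U f - c.U (c.V f)) / (c.y - c.y') := by
  rw [fieldCross, if_pos rfl, if_neg h]

theorem fieldCross_ne {p q : I} (h : p ≠ q) (c : SwapData F) (f : F) :
    fieldCross O p q c f = edgeFactor O p q c.x c.x' * c.U (c.V f) := if_neg h

theorem fieldCross_mul_of_fixed (p q : I) (c : SwapData F) {z : F} (hU : c.U z = z)
    (hV : c.V z = z) (f : F) : fieldCross O p q c (z * f) = z * fieldCross O p q c f := by
  unfold fieldCross
  split_ifs <;> simp only [map_mul, hU, hV] <;> ring

/-- In the real case the quotient is invariant under U, in the imaginary case under V; the same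
operator annihilates such invariants. -/
theorem fieldCross_fieldCross_self (p : I) (c : SwapData F) (f : F) :
    fieldCross O p p c (fieldCross O p p c f) = 0 := by
  have hx := sub_ne_zero.2 c.x_ne
  have hx' := sub_ne_zero.2 c.x_ne.symm
  have hy := sub_ne_zero.2 c.y_ne
  have hy' := sub_ne_zero.2 c.y_ne.symm
  by_cases hp : D.IsReal p
  · simp only [fieldCross_real hp, map_sub, map_div₀, c.Ux, c.Ux', c.UU]
    field_simp
    ring
  · simp only [fieldCross_imag hp, map_sub, map_div₀, c.Uy, c.Uy', c.UU, c.VU, c.VV, c.Vy, c.Vy']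
    field_simp
    ring

theorem fieldCross_fieldCross_orth {p q : I} (hpq : p ≠ q) (h : D.form p q = 0)
    (c : SwapData F) (f : F) : fieldCross O q p c (fieldCross O p q c f) = f := by
  have h' : D.form q p = 0 := by rwa [D.form_comm]
  simp only [fieldCross_ne hpq, fieldCross_ne hpq.symm, edgeFactor_of_form_eq_zero O h,
    edgeFactor_of_form_eq_zero O h', one_mul, c.VU, c.VV, c.UU]

theorem fieldCross_fieldCross_edge {p q : I} (hpq : p ≠ q) (h : D.form p q ≠ 0)
    (c : SwapData F) (f : F) : fieldCross O q p c (fieldCross O p q c f) =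
      (c.x ^ D.negA p q + c.x' ^ D.negA q p) * f := by
  rw [← edgeFactor_mul_edgeFactor O hpq h]
  simp only [fieldCross_ne hpq, fieldCross_ne hpq.symm, map_mul, map_edgeFactor, c.VU, c.VV, c.UU,
    c.Vx, c.Vx', c.Ux, c.Ux', mul_assoc]

/-- Twisted Leibniz rule of the divided difference. -/
theorem x_mul_fieldCross_real {p : I} (hp : D.IsReal p) (c : SwapData F) (f : F) :
    c.x * fieldCross O p p c f - fieldCross O p p c (c.x' * f) = f := by
  have hx := sub_ne_zero.2 c.x_ne
  simp only [fieldCross_real hp, map_mul, c.Ux']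
  field_simp
  ring

theorem fieldCross_x_mul_real {p : I} (hp : D.IsReal p) (c : SwapData F) (f : F) :
    fieldCross O p p c (c.x * f) - c.x' * fieldCross O p p c f = f := by
  have hx := sub_ne_zero.2 c.x_ne
  simp only [fieldCross_real hp, map_mul, c.Ux]
  field_simp
  ring

/-- Outside the equal real case every term of the operator contains U, so the dot changes strand
with no correction. -/
theorem x_mul_fieldCross_other {p q : I} (h : ¬ (p = q ∧ D.IsReal p)) (c : SwapData F) (f : F) :
    c.x * fieldCross O p q c f = fieldCross O p q c (c.x' * f) := by
  unfold fieldCross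
  split_ifs with h1 h2
  · exact absurd ⟨h1, h2⟩ h
  all_goals simp only [map_mul, c.Vx', c.Ux']; ring

theorem fieldCross_x_mul_other {p q : I} (h : ¬ (p = q ∧ D.IsReal p)) (c : SwapData F) (f : F) :
    fieldCross O p q c (c.x * f) = c.x' * fieldCross O p q c f := by
  unfold fieldCross
  split_ifs with h1 h2
  · exact absurd ⟨h1, h2⟩ h
  all_goals simp only [map_mul, c.Vx, c.Ux]; ring

/-- The automorphisms commute, and each operator's coefficients are fixed by the automorphisms of
the other. -/
theorem fieldCross_comm {c d : SwapData F} (h : c.Far d) (p q p' q' : I) (f : F) :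
    fieldCross O p q c (fieldCross O p' q' d f) = fieldCross O p' q' d (fieldCross O p q c f) := by
  unfold fieldCross
  split_ifs <;> simp only [map_sub, map_mul, map_div₀, map_edgeFactor, h.Ux, h.Ux', h.Uy, h.Uy',
    h.Vx, h.Vx', h.Vy, h.Vy', h.xU, h.xU', h.yU, h.yU', h.xV, h.xV', h.yV, h.yV', h.UU, h.UV, h.VU,
    h.VV, c.VU, d.VU] <;> ring

theorem SwapData.Adj.Ux {c d : SwapData F} (h : c.Adj d) : d.U c.x' = d.x' := by
  rw [← h.x_eq, d.Ux]

theorem SwapData.Adj.Uxx {c d : SwapData F} (h : c.Adj d) : d.U d.x' = c.x' := by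
  rw [← h.x_eq, d.Ux']

theorem SwapData.Adj.Uy {c d : SwapData F} (h : c.Adj d) : d.U c.y' = c.y' := by
  rw [← h.y_eq, d.Uy]

theorem SwapData.Adj.Vx {c d : SwapData F} (h : c.Adj d) : d.V c.x' = c.x' := by
  rw [← h.x_eq, d.Vx]

theorem SwapData.Adj.Vy {c d : SwapData F} (h : c.Adj d) : d.V c.y' = d.y' := by
  rw [← h.y_eq, d.Vy]

theorem SwapData.Adj.Vyy {c d : SwapData F} (h : c.Adj d) : d.V d.y' = c.y' := by
  rw [← h.y_eq, d.Vy']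

/-- The classical braid relation of divided differences. -/
theorem fieldCross_braid_real {c d : SwapData F} (h : c.Adj d) {p : I} (hp : D.IsReal p) (f : F) :
    fieldCross O p p c (fieldCross O p p d (fieldCross O p p c f)) =
      fieldCross O p p d (fieldCross O p p c (fieldCross O p p d f)) := by
  have h1 := sub_ne_zero.2 c.x_ne
  have h1' := sub_ne_zero.2 c.x_ne.symm
  have h2 : c.x' - d.x' ≠ 0 := h.x_eq ▸ sub_ne_zero.2 d.x_ne
  have h2' : d.x' - c.x' ≠ 0 := h.x_eq ▸ sub_ne_zero.2 d.x_ne.symm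
  have h3 := sub_ne_zero.2 h.x_ne
  have h3' := sub_ne_zero.2 h.x_ne.symm
  simp only [fieldCross_real hp, map_sub, map_div₀, c.Ux, c.Ux', h.Ux', h.xU, h.Ux, h.Uxx, h.x_eq,
    c.UU, d.UU, h.braidU]
  field_simp
  ring

/-- The operator is U composed with a divided difference in y. These two kinds of factor commute
with each other, and each satisfies the braid relation. -/
theorem fieldCross_braid_imag {c d : SwapData F} (h : c.Adj d) {p : I} (hp : ¬ D.IsReal p)
    (f : F) : fieldCross O p p c (fieldCross O p p d (fieldCross O p p c f)) =
      fieldCross O p p d (fieldCross O p p c (fieldCross O p p d f)) := by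
  have h1 := sub_ne_zero.2 c.y_ne
  have h1' := sub_ne_zero.2 c.y_ne.symm
  have h2 : c.y' - d.y' ≠ 0 := h.y_eq ▸ sub_ne_zero.2 d.y_ne
  have h2' : d.y' - c.y' ≠ 0 := h.y_eq ▸ sub_ne_zero.2 d.y_ne.symm
  have h3 := sub_ne_zero.2 h.y_ne
  have h3' := sub_ne_zero.2 h.y_ne.symm
  simp only [fieldCross_imag hp, map_sub, map_div₀, c.Uy, c.Uy', d.Uy', h.Uy', h.yU, h.Uy, h.y_eq,
    c.Vy, c.Vy', h.Vy', h.yV, h.Vy, h.Vyy, c.VU, d.VU, h.UV, h.VU,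
    c.UU, d.UU, c.VV, d.VV, h.braidU, h.braidV]
  field_simp
  ring

/-- The third strand crosses both equal strands, so the product of its edge factors is symmetric in
them and commutes with their divided difference. -/
theorem fieldCross_braid_left {c d : SwapData F} (h : c.Adj d) {p q : I} (hpq : p ≠ q) (f : F) :
    fieldCross O p q c (fieldCross O p q d (fieldCross O p p c f)) =
      fieldCross O p p d (fieldCross O p q c (fieldCross O p q d f)) := by
  by_cases hp : D.IsReal p
  · simp only [fieldCross_real hp, fieldCross_ne hpq, map_sub, map_div₀, map_mul, map_edgeFactor,
      c.Ux, c.Ux', h.Ux', h.xU, h.Ux, h.Uxx, h.x_eq, c.Vx, c.Vx', h.xV, h.Vx, h.Vx', d.Vx', c.VU,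
      d.VU, h.UV, h.VU, c.UU, d.UU, c.VV, d.VV, h.braidU, h.braidV]
    ring
  · simp only [fieldCross_imag hp, fieldCross_ne hpq, map_sub, map_div₀, map_mul, map_edgeFactor,
      c.Ux, c.Ux', h.Ux', h.xU, h.Ux, h.Uxx, h.x_eq, c.Vx, c.Vx', h.xV, h.Vx, h.Vx', d.Vx', c.VU,
      c.Uy, c.Uy', d.Uy', h.Uy', h.yU, h.Uy, h.y_eq, c.Vy, c.Vy', h.Vy', h.yV, h.Vy, h.Vyy,
      d.VU, h.UV, h.VU, c.UU, d.UU, c.VV, d.VV, h.braidU, h.braidV]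
    ring

theorem fieldCross_braid_right {c d : SwapData F} (h : c.Adj d) {p q : I} (hpq : p ≠ q) (f : F) :
    fieldCross O q q c (fieldCross O p q d (fieldCross O p q c f)) =
      fieldCross O p q d (fieldCross O p q c (fieldCross O q q d f)) := by
  by_cases hp : D.IsReal q
  · simp only [fieldCross_real hp, fieldCross_ne hpq, map_sub, map_div₀, map_mul, map_edgeFactor,
      c.Ux, c.Ux', h.Ux', h.xU, h.Ux, h.Uxx, h.x_eq, c.Vx, c.Vx', h.xV, h.Vx, h.Vx', d.Vx', c.VU,
      d.VU, h.UV, h.VU, c.UU, d.UU, c.VV, d.VV, h.braidU, h.braidV]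
    ring
  · simp only [fieldCross_imag hp, fieldCross_ne hpq, map_sub, map_div₀, map_mul, map_edgeFactor,
      c.Ux, c.Ux', h.Ux', h.xU, h.Ux, h.Uxx, h.x_eq, c.Vx, c.Vx', h.xV, h.Vx, h.Vx', d.Vx', c.VU,
      c.Uy, c.Uy', d.Uy', h.Uy', h.yU, h.Uy, h.y_eq, c.Vy, c.Vy', h.Vy', h.yV, h.Vy, h.Vyy,
      d.VU, h.UV, h.VU, c.UU, d.UU, c.VV, d.VV, h.braidU, h.braidV]
    ring

theorem fieldCross_braid_ne {c d : SwapData F} (h : c.Adj d) {p q r : I} (hpq : p ≠ q)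
    (hpr : p ≠ r) (hqr : q ≠ r) (f : F) :
    fieldCross O q r c (fieldCross O p r d (fieldCross O p q c f)) =
      fieldCross O p q d (fieldCross O p r c (fieldCross O q r d f)) := by
  simp only [fieldCross_ne hpq, fieldCross_ne hpr, fieldCross_ne hqr, map_mul, map_edgeFactor,
    c.Ux, c.Ux', h.Ux', h.xU, h.Ux, h.Uxx, h.x_eq, c.Vx, c.Vx', h.xV, h.Vx, h.Vx', d.Vx', c.VU,
    d.VU, h.UV, h.VU, c.UU, d.UU, c.VV, d.VV, h.braidU, h.braidV]
  ring

/-- Both terms of the middle operator apply the same swap of the x, and edge factors involve only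
the x; hence no defect arises, unlike for real labels. -/
theorem fieldCross_braid_imag_ne {c d : SwapData F} (h : c.Adj d) {p q : I} (hpq : p ≠ q)
    (hp : ¬ D.IsReal p) (f : F) :
    fieldCross O q p c (fieldCross O p p d (fieldCross O p q c f)) =
      fieldCross O p q d (fieldCross O p p c (fieldCross O q p d f)) := by
  simp only [fieldCross_imag hp, fieldCross_ne hpq, fieldCross_ne hpq.symm, map_sub, map_div₀,
    map_mul, map_edgeFactor,
    c.Ux, c.Ux', h.Ux', h.xU, h.Ux, h.Uxx, h.x_eq, c.Vx, c.Vx', h.xV, h.Vx, h.Vx', d.Vx', c.VU,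
    c.Uy, c.Uy', d.Uy', h.Uy', h.yU, h.Uy, h.y_eq, c.Vy, c.Vy', h.Vy', h.yV, h.Vy, h.Vyy,
    d.VU, h.UV, h.VU, c.UU, d.UU, c.VV, d.VV, h.braidU, h.braidV]
  ring

/-- The middle divided difference has two terms. Where it swaps, both sides agree by the braid
relation; where it does not, the outer crossings undo each other and leave a multiple of f. -/
theorem fieldCross_braid_real_ne {c d : SwapData F} (h : c.Adj d) {p q : I} (hpq : p ≠ q)
    (hp : D.IsReal p) (f : F) :
    fieldCross O q p c (fieldCross O p p d (fieldCross O p q c f)) -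
      fieldCross O p q d (fieldCross O p p c (fieldCross O q p d f)) =
        (edgeFactor O q p c.x c.x' * edgeFactor O p q c.x' c.x
          - edgeFactor O q p d.x' c.x' * edgeFactor O p q c.x' d.x') / (c.x - d.x') * f := by
  simp only [fieldCross_real hp, fieldCross_ne hpq, fieldCross_ne hpq.symm, map_sub, map_div₀,
    map_mul, map_edgeFactor,
    c.Ux, c.Ux', h.Ux', h.xU, h.Ux, h.Uxx, h.x_eq, c.Vx, c.Vx', h.xV, h.Vx, h.Vx', d.Vx', c.VU,
    d.VU, h.UV, h.VU, c.UU, d.UU, c.VV, d.VV, h.braidU, h.braidV]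
  ring

/-- The powers of the middle variable cancel in the numerator, and the remaining difference of
powers divided by the difference of variables is a geometric sum. -/
theorem fieldCross_braid_edge {c d : SwapData F} (h : c.Adj d) {p q : I} (hpq : p ≠ q)
    (hp : D.IsReal p) (hf : D.form p q ≠ 0) (f : F) :
    fieldCross O q p c (fieldCross O p p d (fieldCross O p q c f)) -
      fieldCross O p q d (fieldCross O p p c (fieldCross O q p d f)) =
        ∑ m ∈ Finset.range (D.negA p q), c.x ^ m * d.x' ^ (D.negA p q - 1 - m) * f := by
  rw [fieldCross_braid_real_ne h hpq hp, edgeFactor_mul_edgeFactor O hpq hf,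
    edgeFactor_mul_edgeFactor O hpq hf, add_sub_add_right_eq_sub, ← Finset.sum_mul,
    ← (Commute.all c.x d.x').geom_sum₂_mul, mul_div_cancel_right₀ _ (sub_ne_zero.2 h.x_ne)]

theorem fieldCross_braid_other {c d : SwapData F} (h : c.Adj d) {p q r : I}
    (hn : ¬ (p = r ∧ p ≠ q ∧ D.IsReal p ∧ D.form p q ≠ 0)) (f : F) :
    fieldCross O q r c (fieldCross O p r d (fieldCross O p q c f)) =
      fieldCross O p q d (fieldCross O p r c (fieldCross O q r d f)) := by
  by_cases hpr : p = r
  · subst hpr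
    by_cases hpq : p = q
    · subst hpq
      by_cases hp : D.IsReal p
      · exact fieldCross_braid_real h hp f
      · exact fieldCross_braid_imag h hp f
    · by_cases hp : D.IsReal p
      · have h0 : D.form p q = 0 := by
          by_contra h0
          exact hn ⟨rfl, hpq, hp, h0⟩
        have h0' : D.form q p = 0 := by rwa [D.form_comm]
        rw [← sub_eq_zero, fieldCross_braid_real_ne h hpq hp]
        simp [edgeFactor_of_form_eq_zero O h0, edgeFactor_of_form_eq_zero O h0']
      · exact fieldCross_braid_imag_ne h hpq hp f
  · by_cases hpq : p = q
    · subst hpq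
      exact fieldCross_braid_left h hpr f
    · by_cases hqr : q = r
      · subst hqr
        exact fieldCross_braid_right h hpq f
      · exact fieldCross_braid_ne h hpq hpr hqr f

end Swaps

/-! ### The group S_n × S_n acting on K(x,y). -/

section Action

variable {K : Type v} [Field K] {n : ℕ}

variable (K n) in
/-- The field `K(x_1, …, x_n, y_1, …, y_n)`. -/
abbrev Frac : Type v := FractionRing (XY K n)

/-- The embedding of the polynomial ring into its fraction field. -/
noncomputable abbrev toFrac : XY K n →+* Frac K n := algebraMap (XY K n) (Frac K n)

theorem toFrac_injective : Function.Injective (toFrac : XY K n →+* Frac K n) :=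
  IsFractionRing.injective _ _

/-- The automorphism of the polynomial ring that permutes the `x` by `g.1` and the `y` by `g.2`. -/
noncomputable def ren (g : Equiv.Perm (Fin n) × Equiv.Perm (Fin n)) : XY K n ≃ₐ[K] XY K n :=
  MvPolynomial.renameEquiv K (Equiv.sumCongr g.1 g.2)

theorem ren_X (g : Equiv.Perm (Fin n) × Equiv.Perm (Fin n)) (z : Fin n ⊕ Fin n) :
    ren (K := K) g (MvPolynomial.X z) = MvPolynomial.X (Sum.map g.1 g.2 z) := by
  simp [ren]

theorem ren_ren (g h : Equiv.Perm (Fin n) × Equiv.Perm (Fin n)) (f : XY K n) :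
    ren g (ren h f) = ren (g * h) f := by
  have : Equiv.sumCongr g.1 g.2 ∘ Equiv.sumCongr h.1 h.2 = Equiv.sumCongr (g * h).1 (g * h).2 := by
    ext1 z
    rcases z with z | z <;> rfl
  simp only [ren, MvPolynomial.renameEquiv_apply, MvPolynomial.rename_rename, this]

theorem ren_one (f : XY K n) : ren 1 f = f := by
  simp [ren]

theorem permXY_eq_ren (ω : Equiv.Perm (Fin n)) (f : XY K n) : permXY ω f = ren (ω, ω) f := rfl

theorem permX_eq_ren (ω : Equiv.Perm (Fin n)) (f : XY K n) : permX ω f = ren (ω, 1) f := rfl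

/-- The automorphism of the fraction field that permutes the `x` by `g.1` and the `y` by `g.2`. -/
noncomputable def act (g : Equiv.Perm (Fin n) × Equiv.Perm (Fin n)) : Frac K n →+* Frac K n :=
  (IsFractionRing.ringEquivOfRingEquiv (K := Frac K n) (L := Frac K n)
    (ren (K := K) g).toRingEquiv).toRingHom

theorem act_toFrac (g : Equiv.Perm (Fin n) × Equiv.Perm (Fin n)) (f : XY K n) :
    act g (toFrac f) = toFrac (ren g f) :=
  IsFractionRing.ringEquivOfRingEquiv_algebraMap _ _

theorem act_act (g h : Equiv.Perm (Fin n) × Equiv.Perm (Fin n)) (z : Frac K n) :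
    act g (act h z) = act (g * h) z := by
  have : (act g).comp (act h) = act (K := K) (g * h) := by
    refine IsLocalization.ringHom_ext (nonZeroDivisors (XY K n)) (RingHom.ext fun f => ?_)
    simp only [RingHom.comp_apply, act_toFrac, ren_ren]
  exact RingHom.congr_fun this z

theorem act_one (z : Frac K n) : act 1 z = z := by
  have : act 1 = RingHom.id (Frac K n) := by
    refine IsLocalization.ringHom_ext (nonZeroDivisors (XY K n)) (RingHom.ext fun f => ?_)
    simp only [RingHom.comp_apply, act_toFrac, ren_one, RingHom.id_apply]
  exact RingHom.congr_fun this z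

variable (K) in
/-- The variable `x_k` or `y_k` in the fraction field. -/
noncomputable def var (z : Fin n ⊕ Fin n) : Frac K n := toFrac (MvPolynomial.X z)

theorem act_var (g : Equiv.Perm (Fin n) × Equiv.Perm (Fin n)) (z : Fin n ⊕ Fin n) :
    act g (var K z) = var K (Sum.map g.1 g.2 z) := by
  rw [var, act_toFrac, ren_X, var]

theorem var_injective : Function.Injective (var (n := n) K) :=
  toFrac_injective.comp (MvPolynomial.X_injective)

theorem act_act_eq {g h g' h' : Equiv.Perm (Fin n) × Equiv.Perm (Fin n)} (e : g * h = g' * h')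
    (z : Frac K n) : act g (act h z) = act g' (act h' z) := by
  rw [act_act, act_act, e]

theorem act_involutive {g : Equiv.Perm (Fin n) × Equiv.Perm (Fin n)} (e : g * g = 1)
    (z : Frac K n) : act g (act g z) = z := by
  rw [act_act, e, act_one]

variable (K) in
/-- The swaps of `x_k`, `x_{k+1}` and of `y_k`, `y_{k+1}`. -/
noncomputable def swapData (k : Crossing n) : SwapData (Frac K n) where
  x := var K (Sum.inl k.lo)
  x' := var K (Sum.inl k.hi)
  y := var K (Sum.inr k.lo)
  y' := var K (Sum.inr k.hi)
  U := act (simple k, 1)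
  V := act (1, simple k)
  x_ne h := k.lo_ne_hi (Sum.inl_injective (var_injective h))
  y_ne h := k.lo_ne_hi (Sum.inr_injective (var_injective h))
  Ux := by simp [act_var]
  Ux' := by simp [act_var]
  Uy := by simp [act_var]
  Uy' := by simp [act_var]
  Vx := by simp [act_var]
  Vx' := by simp [act_var]
  Vy := by simp [act_var]
  Vy' := by simp [act_var]
  UU := act_involutive (Prod.ext (simple_mul_self k) rfl)
  VV := act_involutive (Prod.ext rfl (simple_mul_self k))
  VU := act_act_eq (Prod.ext rfl rfl)

theorem swapData_UV (k : Crossing n) (z : Frac K n) :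
    (swapData K k).U ((swapData K k).V z) = act (simple k, simple k) z := act_act _ _ z

theorem swapData_far {k l : Crossing n} (h : k.1 + 1 < l.1) :
    (swapData K k).Far (swapData K l) := by
  have h1 : l.lo ≠ k.lo := by simp only [Crossing.lo, ne_eq, Fin.ext_iff]; omega
  have h2 : l.lo ≠ k.hi := by simp only [Crossing.lo, Crossing.hi, ne_eq, Fin.ext_iff]; omega
  have h3 : l.hi ≠ k.lo := by simp only [Crossing.lo, Crossing.hi, ne_eq, Fin.ext_iff]; omega
  have h4 : l.hi ≠ k.hi := by simp only [Crossing.hi, ne_eq, Fin.ext_iff]; omega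
  have a1 := simple_of_ne k h1 h2
  have a2 := simple_of_ne k h3 h4
  have a3 := simple_of_ne l h1.symm h3.symm
  have a4 := simple_of_ne l h2.symm h4.symm
  constructor
  case UU => exact act_act_eq (Prod.ext (simple_comm h).symm rfl)
  case UV => exact act_act_eq (Prod.ext rfl rfl)
  case VU => exact act_act_eq (Prod.ext rfl rfl)
  case VV => exact act_act_eq (Prod.ext rfl (simple_comm h).symm)
  all_goals simp [swapData, act_var, a1, a2, a3, a4]

theorem swapData_adj {k l : Crossing n} (h : l.1 = k.1 + 1) :
    (swapData K k).Adj (swapData K l) := by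
  have a1 := simple_left_hi h
  have a2 := simple_right_lo h
  have a3 := hi_ne_lo_of_adjacent h
  constructor
  case x_eq => exact congrArg (var K ∘ Sum.inl) (lo_eq_hi_of_adjacent h)
  case y_eq => exact congrArg (var K ∘ Sum.inr) (lo_eq_hi_of_adjacent h)
  case x_ne => exact fun g => a3.symm (Sum.inl_injective (var_injective g))
  case y_ne => exact fun g => a3.symm (Sum.inr_injective (var_injective g))
  case UV => exact act_act_eq (Prod.ext rfl rfl)
  case VU => exact act_act_eq (Prod.ext rfl rfl)
  case braidU =>
    intro f
    simp only [swapData, act_act]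
    congr 2
    exact Prod.ext (by simpa [mul_assoc] using (simple_braid h).symm) rfl
  case braidV =>
    intro f
    simp only [swapData, act_act]
    congr 2
    exact Prod.ext rfl (by simpa [mul_assoc] using (simple_braid h).symm)
  all_goals simp [swapData, act_var, a1, a2]

end Action

/-! ### The polynomial representation. -/

section Representation

variable {I : Type u} {K : Type v} [Field K] {D : BorcherdsCartanDatum I} {ν : I →₀ ℕ}

theorem toFrac_realDiff {n : ℕ} (k : Crossing n) (f : XY K n) :
    toFrac (realDiff k f) = (toFrac f - (swapData K k).U (toFrac f)) /
      ((swapData K k).x - (swapData K k).x') := by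
  rw [eq_div_iff (sub_ne_zero.2 (swapData K k).x_ne), mul_comm]
  have h := congrArg toFrac (realDiff_spec k f)
  rw [map_mul, map_sub, map_sub, permX_eq_ren, ← act_toFrac] at h
  exact h.symm

theorem toFrac_imagDiff {n : ℕ} (k : Crossing n) (f : XY K n) :
    toFrac (imagDiff k f) = ((swapData K k).U (toFrac f)
      - (swapData K k).U ((swapData K k).V (toFrac f))) /
      ((swapData K k).y - (swapData K k).y') := by
  rw [eq_div_iff (sub_ne_zero.2 (swapData K k).y_ne), mul_comm, swapData_UV]
  have h := congrArg toFrac (imagDiff_spec k f)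
  rw [map_mul, map_sub, map_sub, permX_eq_ren, permXY_eq_ren, ← act_toFrac, ← act_toFrac] at h
  exact h.symm

/-- The exact quotients become honest divisions in the field. Since the embedding is injective,
linearity and every relation can be checked there. -/
theorem toFrac_crossOp (O : D.Orientation) (k : Crossing (ht ν)) (i : Seq ν)
    (f : XY K (ht ν)) : toFrac (crossOp O k i f) =
      fieldCross O (i.at k.lo) (i.at k.hi) (swapData K k) (toFrac f) := by
  unfold crossOp fieldCross edgeFactor
  split_ifs
  · exact toFrac_realDiff k f
  · exact toFrac_imagDiff k f
  all_goals simp only [permXY_eq_ren, swapData_UV, act_toFrac, one_mul]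
  rw [map_mul, map_add, map_pow, map_pow]
  rfl

theorem fieldCross_add {F : Type v} [Field F] {O : D.Orientation} (p q : I) (c : SwapData F)
    (f g : F) : fieldCross O p q c (f + g) = fieldCross O p q c f + fieldCross O p q c g := by
  unfold fieldCross
  split_ifs <;> simp only [map_add] <;> ring

theorem act_algebraMap {n : ℕ} (g : Equiv.Perm (Fin n) × Equiv.Perm (Fin n)) (c : K) :
    act g (toFrac (MvPolynomial.C c : XY K n)) = toFrac (MvPolynomial.C c) := by
  rw [act_toFrac, ← MvPolynomial.algebraMap_eq, AlgEquiv.commutes]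

/-- The operator by which `τ_{k,i}` acts, as a linear map. -/
noncomputable def crossLin (O : D.Orientation) (k : Crossing (ht ν)) (i : Seq ν) :
    XY K (ht ν) →ₗ[K] XY K (ht ν) where
  toFun := crossOp O k i
  map_add' f g := toFrac_injective <| by
    rw [map_add, toFrac_crossOp, toFrac_crossOp, toFrac_crossOp, map_add, fieldCross_add]
  map_smul' c f := toFrac_injective <| by
    rw [RingHom.id_apply, MvPolynomial.smul_eq_C_mul, MvPolynomial.smul_eq_C_mul, map_mul,
      toFrac_crossOp, toFrac_crossOp, map_mul]
    exact fieldCross_mul_of_fixed _ _ _ (act_algebraMap _ c) (act_algebraMap _ c) _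

theorem toFrac_crossLin (O : D.Orientation) (k : Crossing (ht ν)) (i : Seq ν)
    (f : XY K (ht ν)) : toFrac (crossLin O k i f) =
      fieldCross O (i.at k.lo) (i.at k.hi) (swapData K k) (toFrac f) := toFrac_crossOp O k i f

variable (K) in
/-- Multiplication by `x_k`. -/
noncomputable def mulX {n : ℕ} (k : Fin n) : XY K n →ₗ[K] XY K n :=
  LinearMap.mulLeft K (MvPolynomial.X (Sum.inl k))

theorem toFrac_mulX {n : ℕ} (k : Fin n) (f : XY K n) :
    toFrac (mulX K k f) = var K (Sum.inl k) * toFrac f := map_mul _ _ _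

theorem toFrac_mulX_pow {n : ℕ} (k : Fin n) (m : ℕ) (f : XY K n) :
    toFrac ((mulX K k ^ m) f) = var K (Sum.inl k) ^ m * toFrac f := by
  rw [mulX, LinearMap.pow_mulLeft, LinearMap.mulLeft_apply, map_mul, map_pow]
  rfl

theorem Seq.sw_at {ν : I →₀ ℕ} (i : Seq ν) (k : Crossing (ht ν)) (l : Fin (ht ν)) :
    (i.sw k).at l = i.at (simple k l) := rfl

theorem Seq.sw_eq_self {ν : I →₀ ℕ} (i : Seq ν) {k : Crossing (ht ν)}
    (h : i.at k.lo = i.at k.hi) : i.sw k = i := by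
  refine Subtype.ext (funext fun l => ?_)
  change i.at (simple k l) = i.at l
  by_cases h1 : l = k.lo
  · rw [h1, simple_lo, h]
  by_cases h2 : l = k.hi
  · rw [h2, simple_hi, h]
  rw [simple_of_ne k h1 h2]

theorem Seq.sw_comm {ν : I →₀ ℕ} (i : Seq ν) {k l : Crossing (ht ν)} (h : k.1 + 1 < l.1) :
    (i.sw l).sw k = (i.sw k).sw l := by
  simp only [Seq.sw, Seq.perm_perm, simple_comm h]

theorem Seq.sw_braid {ν : I →₀ ℕ} (i : Seq ν) {k l : Crossing (ht ν)} (h : l.1 = k.1 + 1) :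
    ((i.sw k).sw l).sw k = ((i.sw l).sw k).sw l := by
  simp only [Seq.sw, Seq.perm_perm, ← mul_assoc, simple_braid h]

theorem toFrac_braid_left (O : D.Orientation) {k l : Crossing (ht ν)} (h : l.1 = k.1 + 1)
    (i : Seq ν) (f : XY K (ht ν)) :
    toFrac (crossLin O k ((i.sw k).sw l) (crossLin O l (i.sw k) (crossLin O k i f))) =
      fieldCross O (i.at l.lo) (i.at l.hi) (swapData K k)
        (fieldCross O (i.at k.lo) (i.at l.hi) (swapData K l)
          (fieldCross O (i.at k.lo) (i.at l.lo) (swapData K k) (toFrac f))) := by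
  have e := lo_eq_hi_of_adjacent h
  simp only [toFrac_crossLin, Seq.sw_at]
  rw [simple_right_lo h, simple_right_mid h, simple_left_hi h, e, simple_lo, simple_hi]

theorem toFrac_braid_right (O : D.Orientation) {k l : Crossing (ht ν)} (h : l.1 = k.1 + 1)
    (i : Seq ν) (f : XY K (ht ν)) :
    toFrac (crossLin O l ((i.sw l).sw k) (crossLin O k (i.sw l) (crossLin O l i f))) =
      fieldCross O (i.at k.lo) (i.at l.lo) (swapData K l)
        (fieldCross O (i.at k.lo) (i.at l.hi) (swapData K k)
          (fieldCross O (i.at l.lo) (i.at l.hi) (swapData K l) (toFrac f))) := by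
  have e := lo_eq_hi_of_adjacent h
  have e' : simple l l.hi = k.hi := by rw [simple_hi, e]
  simp only [toFrac_crossLin, Seq.sw_at]
  rw [simple_right_mid h, simple_left_hi h, e', e, simple_hi, simple_right_lo h]

variable [DecidableEq I]

/-- The endomorphism of `𝒫_ν` that is `T : 𝒫_i → 𝒫_j` on `𝒫_i` and zero on the other summands. -/
noncomputable def opAt (i j : Seq ν) (T : XY K (ht ν) →ₗ[K] XY K (ht ν)) :
    Module.End K (Pol K ν) :=
  DirectSum.lof K (Seq ν) (fun i => PolAt K i) j ∘ₗ T ∘ₗ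
    DirectSum.component K (Seq ν) (fun i => PolAt K i) i

theorem opAt_of (i j : Seq ν) (T : XY K (ht ν) →ₗ[K] XY K (ht ν)) (f : XY K (ht ν)) :
    opAt i j T (Pol.of i f) = Pol.of j (T f) := by
  simp only [opAt, Pol.of, LinearMap.comp_apply, DirectSum.component.lof_self]

theorem opAt_of_ne {i i' : Seq ν} (h : i ≠ i') (j : Seq ν) (T : XY K (ht ν) →ₗ[K] XY K (ht ν))
    (f : XY K (ht ν)) : opAt i j T (Pol.of i' f) = 0 := by
  simp only [opAt, Pol.of, LinearMap.comp_apply]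
  rw [DirectSum.component.of, dif_neg h.symm, map_zero, map_zero]

theorem Pol.end_ext {A B : Module.End K (Pol K ν)}
    (h : ∀ (i : Seq ν) (f : XY K (ht ν)), A (Pol.of i f) = B (Pol.of i f)) : A = B :=
  DirectSum.linearMap_ext K fun i => LinearMap.ext fun f => h i f

theorem Pol.of_injective (i : Seq ν) :
    Function.Injective (Pol.of i : XY K (ht ν) → Pol K ν) := DirectSum.of_injective i

theorem opAt_mul_opAt (i j l : Seq ν) (S T : XY K (ht ν) →ₗ[K] XY K (ht ν)) :
    opAt j l S * opAt i j T = opAt i l (S ∘ₗ T) := by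
  refine Pol.end_ext fun i' f => ?_
  rw [Module.End.mul_apply]
  by_cases h : i = i'
  · subst h
    rw [opAt_of, opAt_of, opAt_of, LinearMap.comp_apply]
  · rw [opAt_of_ne h, opAt_of_ne h, map_zero]

theorem opAt_mul_opAt_of_ne {i j j' l : Seq ν} (h : j' ≠ j)
    (S T : XY K (ht ν) →ₗ[K] XY K (ht ν)) : opAt j l S * opAt i j' T = 0 := by
  refine Pol.end_ext fun i' f => ?_
  rw [Module.End.mul_apply]
  by_cases h' : i = i'
  · subst h'
    rw [opAt_of, opAt_of_ne h.symm, LinearMap.zero_apply]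
  · rw [opAt_of_ne h', map_zero, LinearMap.zero_apply]

theorem opAt_sub (i j : Seq ν) (S T : XY K (ht ν) →ₗ[K] XY K (ht ν)) :
    opAt i j S - opAt i j T = opAt i j (S - T) := by
  simp only [opAt, LinearMap.sub_comp, LinearMap.comp_sub]

theorem opAt_add (i j : Seq ν) (S T : XY K (ht ν) →ₗ[K] XY K (ht ν)) :
    opAt i j S + opAt i j T = opAt i j (S + T) := by
  simp only [opAt, LinearMap.add_comp, LinearMap.comp_add]

theorem opAt_congr {i j : Seq ν} {S T : XY K (ht ν) →ₗ[K] XY K (ht ν)}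
    (h : ∀ f, toFrac (S f) = toFrac (T f)) : opAt i j S = opAt i j T := by
  rw [LinearMap.ext fun f => toFrac_injective (h f)]

theorem opAt_zero (i j : Seq ν) : opAt i j (0 : XY K (ht ν) →ₗ[K] XY K (ht ν)) = 0 := by
  simp only [opAt, LinearMap.zero_comp, LinearMap.comp_zero]

theorem opAt_sum {α : Type*} (s : Finset α) (i j : Seq ν)
    (T : α → XY K (ht ν) →ₗ[K] XY K (ht ν)) :
    ∑ c ∈ s, opAt i j (T c) = opAt i j (∑ c ∈ s, T c) := by
  classical
  induction s using Finset.induction_on with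
  | empty => simp [opAt_zero]
  | insert a s ha ih => rw [Finset.sum_insert ha, Finset.sum_insert ha, ih, opAt_add]

/-- True also for m = 0, because the right factor already lands in summand j; `opAt_pow` has to
exclude m = 0, where the left side is the identity of all of 𝒫_ν. -/
theorem opAt_pow_mul (i j : Seq ν) (S T : XY K (ht ν) →ₗ[K] XY K (ht ν)) (m : ℕ) :
    opAt j j S ^ m * opAt i j T = opAt i j ((S ^ m) ∘ₗ T) := by
  induction m with
  | zero => rw [pow_zero, pow_zero, one_mul]; rfl
  | succ m ih =>
    rw [pow_succ', pow_succ', mul_assoc, ih, opAt_mul_opAt]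
    rfl

theorem opAt_pow (i : Seq ν) (S : XY K (ht ν) →ₗ[K] XY K (ht ν)) {m : ℕ} (hm : m ≠ 0) :
    opAt i i S ^ m = opAt i i (S ^ m) := by
  obtain ⟨m, rfl⟩ := Nat.exists_eq_succ_of_ne_zero hm
  rw [Nat.succ_eq_add_one, pow_succ, opAt_pow_mul, pow_succ]
  rfl

/-- The action of the generators of `R(ν)` on `𝒫_ν`. -/
noncomputable def genAction (O : D.Orientation) : Gen ν → Module.End K (Pol K ν)
  | Gen.idem i => opAt i i LinearMap.id
  | Gen.dot k i => opAt i i (mulX K k)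
  | Gen.cross k i => opAt i (i.sw k) (crossLin O k i)

/-- The action of the free algebra on the generators of `R(ν)`. -/
noncomputable def freeAction (O : D.Orientation) :
    FreeAlgebra K (Gen ν) →ₐ[K] Module.End K (Pol K ν) := FreeAlgebra.lift K (genAction O)

theorem freeAction_fe (O : D.Orientation) (i : Seq ν) :
    freeAction O (fe K i) = opAt i i LinearMap.id := FreeAlgebra.lift_ι_apply _ _

theorem freeAction_fx (O : D.Orientation) (k : Fin (ht ν)) (i : Seq ν) :
    freeAction O (fx K k i) = opAt i i (mulX K k) := FreeAlgebra.lift_ι_apply _ _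

theorem freeAction_ft (O : D.Orientation) (k : Crossing (ht ν)) (i : Seq ν) :
    freeAction O (ft K k i) = opAt i (i.sw k) (crossLin O k i) := FreeAlgebra.lift_ι_apply _ _

variable [Fintype I]

theorem sum_opAt_id : ∑ i : Seq ν, opAt i i (LinearMap.id : XY K (ht ν) →ₗ[K] XY K (ht ν)) = 1 := by
  refine Pol.end_ext fun j f => ?_
  rw [LinearMap.sum_apply, Finset.sum_eq_single j, opAt_of]
  · rfl
  · exact fun i _ h => opAt_of_ne h _ _ _
  · exact fun h => absurd (Finset.mem_univ j) h

theorem freeAction_rel (O : D.Orientation) {a b : FreeAlgebra K (Gen ν)} (h : Rel K D ν a b) :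
    freeAction O a = freeAction O b := by
  induction h with
  | idem_idem i => rw [map_mul, freeAction_fe, opAt_mul_opAt, LinearMap.comp_id]
  | idem_ne i j h => rw [map_mul, freeAction_fe, freeAction_fe, opAt_mul_opAt_of_ne h.symm, map_zero]
  | idem_sum => simp only [map_sum, freeAction_fe, sum_opAt_id, map_one]
  | idem_dot k i =>
    rw [map_mul, freeAction_fe, freeAction_fx, opAt_mul_opAt, LinearMap.id_comp]
  | dot_idem k i =>
    rw [map_mul, freeAction_fe, freeAction_fx, opAt_mul_opAt, LinearMap.comp_id]
  | idem_cross k i =>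
    rw [map_mul, freeAction_fe, freeAction_ft, opAt_mul_opAt, LinearMap.id_comp]
  | cross_idem k i =>
    rw [map_mul, freeAction_fe, freeAction_ft, opAt_mul_opAt, LinearMap.comp_id]
  | dot_dot k l i =>
    simp only [map_mul, freeAction_fx, opAt_mul_opAt]
    refine opAt_congr fun f => ?_
    simp only [LinearMap.comp_apply, toFrac_mulX]
    ring
  | dot_cross k l i h1 h2 =>
    simp only [map_mul, freeAction_fx, freeAction_ft, opAt_mul_opAt]
    refine opAt_congr fun f => ?_
    simp only [LinearMap.comp_apply, toFrac_mulX, toFrac_crossLin]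
    refine (fieldCross_mul_of_fixed _ _ _ ?_ ?_ _).symm
    · simp [swapData, act_var, simple_of_ne k h1 h2]
    · simp [swapData, act_var]
  | cross_cross k l i h =>
    simp only [map_mul, freeAction_ft, opAt_mul_opAt]
    -- The two composites must have syntactically the same target summand before they can be
    -- compared.
    rw [Seq.sw_comm i h]
    refine opAt_congr fun f => ?_
    have h1 : l.lo ≠ k.lo := by simp only [Crossing.lo, ne_eq, Fin.ext_iff]; omega
    have h2 : l.lo ≠ k.hi := by simp only [Crossing.lo, Crossing.hi, ne_eq, Fin.ext_iff]; omega
    have h3 : l.hi ≠ k.lo := by simp only [Crossing.lo, Crossing.hi, ne_eq, Fin.ext_iff]; omega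
    have h4 : l.hi ≠ k.hi := by simp only [Crossing.hi, ne_eq, Fin.ext_iff]; omega
    simp only [LinearMap.comp_apply, toFrac_crossLin, Seq.sw_at, simple_of_ne k h1 h2,
      simple_of_ne k h3 h4, simple_of_ne l h1.symm h3.symm, simple_of_ne l h2.symm h4.symm]
    exact fieldCross_comm (swapData_far h) _ _ _ _ _
  | double_same k i h =>
    simp only [map_mul, freeAction_ft, opAt_mul_opAt, map_zero]
    rw [← opAt_zero i ((i.sw k).sw k)]
    refine opAt_congr fun f => ?_
    simp only [LinearMap.comp_apply, toFrac_crossLin, Seq.sw_at, simple_lo, simple_hi, h]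
    rw [fieldCross_fieldCross_self, LinearMap.zero_apply, map_zero]
  | double_orth k i h h0 =>
    simp only [map_mul, freeAction_ft, opAt_mul_opAt, freeAction_fe, Seq.sw_sw]
    refine opAt_congr fun f => ?_
    simp only [LinearMap.comp_apply, toFrac_crossLin, Seq.sw_at, simple_lo, simple_hi]
    rw [fieldCross_fieldCross_orth h h0, LinearMap.id_apply]
  | double_edge k i h h0 =>
    simp only [map_mul, map_add, map_pow, freeAction_ft, opAt_mul_opAt, freeAction_fx, Seq.sw_sw]
    rw [opAt_pow i _ (D.negA_ne_zero h h0),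
      opAt_pow i _ (D.negA_ne_zero h.symm (by rwa [D.form_comm])), opAt_add]
    refine opAt_congr fun f => ?_
    simp only [LinearMap.comp_apply, toFrac_crossLin, Seq.sw_at, simple_lo, simple_hi,
      LinearMap.add_apply, map_add, toFrac_mulX_pow]
    rw [fieldCross_fieldCross_edge h h0, add_mul]
    rfl
  | slide_real k i h hr =>
    simp only [map_sub, map_mul, freeAction_fx, freeAction_ft, freeAction_fe, opAt_mul_opAt]
    -- Equal labels give s_k(i) = i, so all three operators act within the summand of i.
    rw [i.sw_eq_self h, opAt_sub]
    refine opAt_congr fun f => ?_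
    simp only [LinearMap.sub_apply, map_sub, LinearMap.comp_apply, toFrac_mulX, toFrac_crossLin, ← h]
    exact x_mul_fieldCross_real hr (swapData K k) _
  | slide_real' k i h hr =>
    simp only [map_sub, map_mul, freeAction_fx, freeAction_ft, freeAction_fe, opAt_mul_opAt]
    rw [i.sw_eq_self h, opAt_sub]
    refine opAt_congr fun f => ?_
    simp only [LinearMap.sub_apply, map_sub, LinearMap.comp_apply, toFrac_mulX, toFrac_crossLin, ← h]
    exact fieldCross_x_mul_real hr (swapData K k) _
  | slide_other k i h =>
    simp only [map_mul, freeAction_fx, freeAction_ft, opAt_mul_opAt]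
    refine opAt_congr fun f => ?_
    simp only [LinearMap.comp_apply, toFrac_mulX, toFrac_crossLin]
    exact x_mul_fieldCross_other h (swapData K k) _
  | slide_other' k i h =>
    simp only [map_mul, freeAction_fx, freeAction_ft, opAt_mul_opAt]
    refine opAt_congr fun f => ?_
    simp only [LinearMap.comp_apply, toFrac_mulX, toFrac_crossLin]
    exact fieldCross_x_mul_other h (swapData K k) _
  | braid_edge k l i h h1 h2 h3 h4 =>
    -- The braid is the transposition of the two outer positions, which carry equal labels; both
    -- composites therefore end in the summand of i, where the dots act.
    have e : ((i.sw l).sw k).sw l = i := by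
      have e0 := lo_eq_hi_of_adjacent h
      have hs : simple l * simple k * simple l = Equiv.swap k.lo l.hi := by
        rw [← simple_braid h]
        have := Equiv.swap_mul_swap_mul_swap (x := l.hi) (y := k.hi) (z := k.lo)
          (hi_ne_hi_of_adjacent h) (hi_ne_lo_of_adjacent h)
        rw [simple, simple, e0, Equiv.swap_comm k.lo k.hi, Equiv.swap_comm k.hi l.hi, this]
      simp only [Seq.sw, Seq.perm_perm, ← mul_assoc, hs]
      refine Subtype.ext (funext fun m => ?_)
      change i.at (Equiv.swap k.lo l.hi m) = i.at m
      rw [Equiv.swap_apply_def]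
      split_ifs with g1 g2
      · rw [g1, h1]
      · rw [g2, h1]
      · rfl
    simp only [map_sub, map_mul, map_sum, map_pow, freeAction_fx, freeAction_ft, freeAction_fe,
      opAt_mul_opAt, mul_assoc, opAt_pow_mul]
    rw [Seq.sw_braid i h, opAt_sub, opAt_sum, e]
    refine opAt_congr fun f => ?_
    simp only [LinearMap.sub_apply, map_sub, LinearMap.sum_apply, map_sum, LinearMap.comp_apply,
      LinearMap.id_apply, toFrac_mulX_pow, toFrac_braid_left O h, toFrac_braid_right O h, ← h1]
    rw [fieldCross_braid_edge (swapData_adj h) h2 h3 h4]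
    simp only [mul_assoc]
    rfl
  | braid_other k l i h hn =>
    simp only [map_mul, freeAction_ft, opAt_mul_opAt]
    rw [Seq.sw_braid i h]
    refine opAt_congr fun f => ?_
    simp only [LinearMap.comp_apply, toFrac_braid_left O h, toFrac_braid_right O h]
    exact fieldCross_braid_other (swapData_adj h) hn _

/-- The polynomial representation of `R(ν)`. -/
noncomputable def polyRep (O : D.Orientation) : R K D ν →ₐ[K] Module.End K (Pol K ν) :=
  RingQuot.liftAlgHom K ⟨freeAction O, fun _ _ h => freeAction_rel O h⟩

theorem polyRep_mk (O : D.Orientation) (a : FreeAlgebra K (Gen ν)) :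
    polyRep O (RingQuot.mkAlgHom K (Rel K D ν) a) = freeAction O a :=
  RingQuot.liftAlgHom_mkAlgHom_apply _ _ _ _

theorem polyRep_e (O : D.Orientation) (i : Seq ν) :
    polyRep O (e K D i) = opAt i i LinearMap.id := (polyRep_mk O _).trans (freeAction_fe O i)

theorem polyRep_x (O : D.Orientation) (k : Fin (ht ν)) (i : Seq ν) :
    polyRep O (x K D k i) = opAt i i (mulX K k) := (polyRep_mk O _).trans (freeAction_fx O k i)

theorem polyRep_t (O : D.Orientation) (k : Crossing (ht ν)) (i : Seq ν) :
    polyRep O (t K D k i) = opAt i (i.sw k) (crossLin O k i) :=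
  (polyRep_mk O _).trans (freeAction_ft O k i)

theorem isPolynomialAction_polyRep (O : D.Orientation) :
    IsPolynomialAction O (polyRep (K := K) (D := D) (ν := ν) O) where
  zero i j k h z hz f := by
    rw [← (mem_component.1 hz).2, map_mul, Module.End.mul_apply, polyRep_e, opAt_of_ne h, map_zero]
  idem i f := by rw [polyRep_e, opAt_of]; rfl
  dot k i f := by rw [polyRep_x, opAt_of]; rfl
  cross k i f := by rw [polyRep_t, opAt_of]; rfl

end Representation

/-! ### Operators as combinations of automorphisms over K(x,y). -/

section Expansion

variable {K : Type v} [Field K] {n : ℕ}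

/-- `T` is the operator `∑ c_g g`. -/
def HasExpansion (T : XY K n → XY K n)
    (c : Equiv.Perm (Fin n) × Equiv.Perm (Fin n) → Frac K n) : Prop :=
  ∀ f, toFrac (T f) = ∑ g, c g * toFrac (ren g f)

theorem hasExpansion_id : HasExpansion (K := K) (n := n) id (Pi.single 1 1) := by
  intro f
  rw [Finset.sum_eq_single 1]
  · rw [Pi.single_eq_same, one_mul, ren_one, id]
  · intro g _ hg
    rw [Pi.single_eq_of_ne hg, zero_mul]
  · exact fun h => absurd (Finset.mem_univ _) h

/-- Multiplication in the skew group algebra: h moves past a coefficient by acting on it. -/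
theorem sum_mul_act (c : Equiv.Perm (Fin n) × Equiv.Perm (Fin n) → Frac K n)
    (h : Equiv.Perm (Fin n) × Equiv.Perm (Fin n)) (f : XY K n) :
    act h (∑ g, c g * toFrac (ren g f)) = ∑ g, act h (c (h⁻¹ * g)) * toFrac (ren g f) := by
  rw [map_sum]
  refine Fintype.sum_equiv (Equiv.mulLeft h) _ _ fun g => ?_
  rw [Equiv.coe_mulLeft, inv_mul_cancel_left, map_mul, act_toFrac, ren_ren]

theorem HasExpansion.comp {T S : XY K n → XY K n}
    {c : Equiv.Perm (Fin n) × Equiv.Perm (Fin n) → Frac K n} (hT : HasExpansion T c)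
    {α β : Frac K n} {g h : Equiv.Perm (Fin n) × Equiv.Perm (Fin n)}
    (hS : ∀ f, toFrac (S f) = α * act g (toFrac f) + β * act h (toFrac f)) :
    HasExpansion (S ∘ T) fun k => α * act g (c (g⁻¹ * k)) + β * act h (c (h⁻¹ * k)) := by
  intro f
  rw [Function.comp_apply, hS, hT, sum_mul_act, sum_mul_act, Finset.mul_sum, Finset.mul_sum,
    ← Finset.sum_add_distrib]
  refine Finset.sum_congr rfl fun k _ => ?_
  ring

/-- The unique maximal term survives a further crossing: g raises weights by at most δ and that of
`top` by exactly δ, while a second term h occurs only with δ = 1 and raises nothing, so it stays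
strictly below g·top. -/
theorem leading_comp {W : Equiv.Perm (Fin n) × Equiv.Perm (Fin n) → ℕ}
    {c : Equiv.Perm (Fin n) × Equiv.Perm (Fin n) → Frac K n}
    {top g h : Equiv.Perm (Fin n) × Equiv.Perm (Fin n)} {α β : Frac K n} {δ : ℕ}
    (hc : c top ≠ 0) (hα : α ≠ 0) (hlt : ∀ k, c k ≠ 0 → k ≠ top → W k < W top)
    (hg : ∀ k, c k ≠ 0 → W (g * k) ≤ W k + δ) (hgt : W (g * top) = W top + δ)
    (hh : β ≠ 0 → δ = 1 ∧ ∀ k, c k ≠ 0 → W (h * k) ≤ W k) :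
    α * act g (c (g⁻¹ * (g * top))) + β * act h (c (h⁻¹ * (g * top))) ≠ 0 ∧
      ∀ k, α * act g (c (g⁻¹ * k)) + β * act h (c (h⁻¹ * k)) ≠ 0 → k ≠ g * top →
        W k < W (g * top) := by
  have hle : ∀ k, c k ≠ 0 → W k ≤ W top := by
    intro k hk
    by_cases h1 : k = top
    · rw [h1]
    · exact (hlt k hk h1).le
  have key : ∀ k, β * act h (c (h⁻¹ * k)) ≠ 0 → W k < W (g * top) := by
    intro k hk
    obtain ⟨hδ, h2⟩ := hh (left_ne_zero_of_mul hk)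
    have hk' := (map_ne_zero _).1 (right_ne_zero_of_mul hk)
    have h3 := h2 _ hk'
    rw [mul_inv_cancel_left] at h3
    have := hle _ hk'
    omega
  constructor
  · have h0 : β * act h (c (h⁻¹ * (g * top))) = 0 := by
      by_contra h0
      exact lt_irrefl _ (key _ h0)
    rw [h0, add_zero, inv_mul_cancel_left]
    exact mul_ne_zero hα ((map_ne_zero _).2 hc)
  · intro k hk hne
    by_cases h0 : β * act h (c (h⁻¹ * k)) = 0
    · rw [h0, add_zero] at hk
      have hk' := (map_ne_zero _).1 (right_ne_zero_of_mul hk)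
      have h1 := hg _ hk'
      have h2 := hlt _ hk' fun e => hne (by rw [← e, mul_inv_cancel_left])
      rw [mul_inv_cancel_left] at h1
      omega
    · exact key k h0

theorem ren_hom_injective : Function.Injective fun g : Equiv.Perm (Fin n) × Equiv.Perm (Fin n) =>
    ((toFrac (K := K)).comp (ren (K := K) g : XY K n →+* XY K n) : XY K n →* Frac K n) := by
  intro g h e
  have key : ∀ z, Sum.map g.1 g.2 z = Sum.map h.1 h.2 z := by
    intro z
    have h1 := DFunLike.congr_fun e (MvPolynomial.X z)
    have h2 : ren (K := K) g (MvPolynomial.X z) = ren h (MvPolynomial.X z) := toFrac_injective h1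
    rw [ren_X, ren_X] at h2
    exact MvPolynomial.X_injective h2
  exact Prod.ext (Equiv.ext fun k => Sum.inl_injective (key (Sum.inl k)))
    (Equiv.ext fun k => Sum.inr_injective (key (Sum.inr k)))

/-- Distinct automorphisms are linearly independent. -/
theorem eq_zero_of_sum_ren {c : Equiv.Perm (Fin n) × Equiv.Perm (Fin n) → Frac K n}
    (h : ∀ f : XY K n, ∑ g, c g * toFrac (ren g f) = 0) (g) : c g = 0 := by
  have hl := (linearIndependent_monoidHom (XY K n) (Frac K n)).comp _
    (ren_hom_injective (K := K) (n := n))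
  refine Fintype.linearIndependent_iff.1 hl c (funext fun f => ?_) g
  rw [Finset.sum_apply, Pi.zero_apply, ← h f]
  rfl

/-- Unitriangularity. Several leading automorphisms may share a weight, but each operator has only
one term of its own maximal weight, so none can cancel the leading term of a maximal one. -/
theorem eq_zero_of_sum_expansion {Ω : Type*} [Fintype Ω] {T : Ω → XY K n → XY K n}
    {c : Ω → Equiv.Perm (Fin n) × Equiv.Perm (Fin n) → Frac K n}
    (hT : ∀ ω, HasExpansion (T ω) (c ω)) (W : Equiv.Perm (Fin n) × Equiv.Perm (Fin n) → ℕ)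
    {top : Ω → Equiv.Perm (Fin n) × Equiv.Perm (Fin n)} (htop : Function.Injective top)
    (hc : ∀ ω, c ω (top ω) ≠ 0) (hlt : ∀ ω k, c ω k ≠ 0 → k ≠ top ω → W k < W (top ω))
    {q : Ω → XY K n} (h : ∀ f, ∑ ω, T ω (q ω * f) = 0) : q = 0 := by
  classical
  by_contra hq
  obtain ⟨ω', hω'⟩ := Function.ne_iff.1 hq
  obtain ⟨ω, hω, hmax⟩ := Finset.exists_max_image (Finset.univ.filter fun ω => q ω ≠ 0)
    (fun ω => W (top ω)) ⟨ω', by simpa using hω'⟩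
  have hω0 : q ω ≠ 0 := (Finset.mem_filter.1 hω).2
  -- The coefficient of each automorphism g in the whole sum vanishes; q enters it through g(q).
  have h1 : ∀ g, ∑ ω, c ω g * toFrac (ren g (q ω)) = 0 := by
    refine eq_zero_of_sum_ren fun f => ?_
    rw [← map_zero toFrac, ← h f, map_sum]
    simp only [Finset.sum_mul]
    rw [Finset.sum_comm]
    refine Finset.sum_congr rfl fun ω _ => ?_
    rw [hT]
    refine Finset.sum_congr rfl fun g _ => ?_
    rw [map_mul, map_mul, mul_assoc]
  have h2 := h1 (top ω)
  rw [Finset.sum_eq_single ω] at h2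
  · refine mul_ne_zero (hc ω) ?_ h2
    rw [map_ne_zero_iff _ toFrac_injective, map_ne_zero_iff _ (ren _).injective]
    exact hω0
  · intro ω₁ _ hne
    by_cases hq1 : q ω₁ = 0
    · rw [hq1, map_zero, map_zero, mul_zero]
    · by_contra hc1
      have h3 := hlt ω₁ (top ω) (left_ne_zero_of_mul hc1) fun e => hne (htop e).symm
      exact absurd (hmax ω₁ (by simpa using hq1)) (not_le.2 h3)
  · exact fun h => absurd (Finset.mem_univ _) h

end Expansion

/-! ### The leading automorphism of a reduced word. -/

section Leading

variable {I : Type u} {K : Type v} [Field K] {D : BorcherdsCartanDatum I} {ν : I →₀ ℕ}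

variable (D) in
/-- The number of inversions of `g.1` between equal real entries of `i`, plus the number of
inversions of `g.2` between equal imaginary entries. -/
noncomputable def weight (i : Seq ν)
    (g : Equiv.Perm (Fin (ht ν)) × Equiv.Perm (Fin (ht ν))) : ℕ :=
  inv (fun a b => i.at a = i.at b ∧ D.IsReal (i.at a)) g.1 +
    inv (fun a b => i.at a = i.at b ∧ ¬ D.IsReal (i.at a)) g.2

theorem Seq.at_inv {i j : Seq ν} {σ : Equiv.Perm (Fin (ht ν))} (h : i.perm σ = j)
    (k : Fin (ht ν)) : i.at (σ⁻¹ k) = j.at k := by rw [← h, Seq.perm_at]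

theorem edgeFactor_var_ne_zero (O : D.Orientation) {p q : I} (hpq : p ≠ q) {n : ℕ}
    (k : Crossing n) : edgeFactor O p q (swapData K k).x (swapData K k).x' ≠ 0 := by
  unfold edgeFactor
  split_ifs with h0 h1
  · exact one_ne_zero
  · exact one_ne_zero
  · have h0' : D.form q p ≠ 0 := by rwa [D.form_comm]
    change toFrac (MvPolynomial.X (Sum.inl k.lo)) ^ _
      + toFrac (MvPolynomial.X (Sum.inl k.hi)) ^ _ ≠ 0
    rw [← map_pow, ← map_pow, ← map_add, map_ne_zero_iff _ toFrac_injective]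
    intro h
    -- At x_k = 1 and all other variables 0 the factor takes the value 1, in every characteristic,
    -- since the exponent of x_{k+1} is positive.
    have h2 := congrArg (MvPolynomial.eval fun z => if z = Sum.inl k.lo then (1 : K) else 0) h
    simp [k.lo_ne_hi.symm, D.negA_ne_zero hpq h0] at h2

/-- The composite of the operators of the crossings in a word. -/
noncomputable def wordLin (O : D.Orientation) (i : Seq ν) :
    List (Crossing (ht ν)) → XY K (ht ν) →ₗ[K] XY K (ht ν)
  | [] => LinearMap.id
  | k :: w => crossLin O k (i.perm (wordPerm w)) ∘ₗ wordLin O i w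

/-- Reducedness says that each new crossing adds an inversion to the x-part of `top`. For imaginary
labels the weight reads the y-part instead, which is why `top.2` must follow `top.1` on imaginary
strands. The condition on the support makes every occurring g carry i to the same sequence, so all
terms see the same labels at k and k+1. -/
theorem exists_leading (O : D.Orientation) (i : Seq ν) {w : List (Crossing (ht ν))}
    (hw : Reduced w) : ∃ (top : Equiv.Perm (Fin (ht ν)) × Equiv.Perm (Fin (ht ν)))
      (c : Equiv.Perm (Fin (ht ν)) × Equiv.Perm (Fin (ht ν)) → Frac K (ht ν)),
      top.1 = wordPerm w ∧ (∀ a, ¬ D.IsReal (i.at a) → top.2 a = top.1 a) ∧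
      HasExpansion (wordLin (K := K) O i w) c ∧ c top ≠ 0 ∧
      (∀ g, c g ≠ 0 → i.perm g.1 = i.perm (wordPerm w) ∧ i.perm g.2 = i.perm (wordPerm w)) ∧
      ∀ g, c g ≠ 0 → g ≠ top → weight D i g < weight D i top := by
  induction w with
  | nil =>
    have h1 : ∀ g, (Pi.single 1 1 : Equiv.Perm (Fin (ht ν)) × Equiv.Perm (Fin (ht ν)) →
        Frac K (ht ν)) g ≠ 0 → g = 1 := by
      intro g hg
      by_contra hne
      exact hg (Pi.single_eq_of_ne hne _)
    refine ⟨1, Pi.single 1 1, rfl, fun _ _ => rfl, hasExpansion_id, by simp, ?_, ?_⟩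
    · intro g hg
      rw [h1 g hg]
      exact ⟨rfl, rfl⟩
    · exact fun g hg hne => absurd (h1 g hg) hne
  | cons k w ih =>
    obtain ⟨top, c, ht1, ht2, hT, hc, hs, hlt⟩ := ih hw.tail
    have hk := hw.lt_of_cons
    generalize hj : i.perm (wordPerm w) = j at hs
    have hlo : ∀ {σ}, i.perm σ = j → i.at (σ⁻¹ k.lo) = j.at k.lo := fun h => Seq.at_inv h _
    have hhi : ∀ {σ}, i.perm σ = j → i.at (σ⁻¹ k.hi) = j.at k.hi := fun h => Seq.at_inv h _
    have hsw : ∀ {σ}, i.perm σ = j → i.perm (simple k * σ) = j.sw k := by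
      intro σ h
      rw [← h]
      rfl
    -- it suffices to write the crossing as a sum of two automorphisms
    suffices H : ∃ (g h : Equiv.Perm (Fin (ht ν)) × Equiv.Perm (Fin (ht ν))) (α β : Frac K (ht ν))
        (δ : ℕ), g.1 = simple k ∧
        (∀ a, ¬ D.IsReal (i.at a) → (g * top).2 a = (g * top).1 a) ∧
        (∀ z, fieldCross O (j.at k.lo) (j.at k.hi) (swapData K k) z =
          α * act g z + β * act h z) ∧ α ≠ 0 ∧
        (∀ x, i.perm x.1 = j → i.perm x.2 = j → weight D i (g * x) ≤ weight D i x + δ) ∧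
        weight D i (g * top) = weight D i top + δ ∧
        (∀ x, i.perm x.1 = j → i.perm x.2 = j →
          i.perm (g * x).1 = j.sw k ∧ i.perm (g * x).2 = j.sw k) ∧
        (β ≠ 0 → δ = 1 ∧ ∀ x, i.perm x.1 = j → i.perm x.2 = j → weight D i (h * x) ≤ weight D i x ∧
          i.perm (h * x).1 = j.sw k ∧ i.perm (h * x).2 = j.sw k) by
      obtain ⟨g, h, α, β, δ, H1, H2, H3, H4, H5, H6, H7, H8⟩ := H
      have hl := leading_comp (W := weight D i) (g := g) (h := h) (β := β) hc H4 hlt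
        (fun x hx => H5 x (hs x hx).1 (hs x hx).2) H6
        (fun hβ => ⟨(H8 hβ).1, fun x hx => ((H8 hβ).2 x (hs x hx).1 (hs x hx).2).1⟩)
      have hS : ∀ f, toFrac (crossLin O k (i.perm (wordPerm w)) f) =
          α * act g (toFrac f) + β * act h (toFrac f) := fun f => by
        rw [toFrac_crossLin, hj, H3]
      refine ⟨g * top, _, ?_, H2, hT.comp hS, hl.1, fun x hx => ?_, hl.2⟩
      · rw [Prod.fst_mul, H1, ht1, wordPerm_cons]
      · rw [Seq.perm_wordPerm_cons, hj]
        by_cases h0 : c (g⁻¹ * x) = 0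
        · rw [h0, map_zero, mul_zero, zero_add] at hx
          have hx' := (map_ne_zero _).1 (right_ne_zero_of_mul hx)
          have := ((H8 (left_ne_zero_of_mul hx)).2 _ (hs _ hx').1 (hs _ hx').2).2
          rwa [mul_inv_cancel_left] at this
        · have := H7 _ (hs _ h0).1 (hs _ h0).2
          rwa [mul_inv_cancel_left] at this
    have htop1 : i.perm top.1 = j := (hs top hc).1
    have htop2 : i.perm top.2 = j := (hs top hc).2
    rw [← ht1] at hk
    by_cases hpq : j.at k.lo = j.at k.hi
    · have hself : j.sw k = j := j.sw_eq_self hpq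
      by_cases hr : D.IsReal (j.at k.lo)
      -- Equal real labels: the x-swap leads, and the identity is the lower term.
      · refine ⟨(simple k, 1), 1, -((swapData K k).x - (swapData K k).x')⁻¹,
          ((swapData K k).x - (swapData K k).x')⁻¹, 1, rfl, ?_, ?_, ?_, ?_, ?_, ?_, ?_⟩
        · intro a ha
          have hja : j.at (top.1 a) = i.at a := by
            rw [← Seq.at_inv htop1]; simp
          -- The crossing strands are real, so an imaginary strand is not moved.
          have h1 : top.1 a ≠ k.lo := fun e => ha (by rwa [← hja, e])
          have h2 : top.1 a ≠ k.hi := fun e => ha (by rwa [← hja, e, ← hpq])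
          rw [Prod.fst_mul, Prod.snd_mul, one_mul, Equiv.Perm.mul_apply, simple_of_ne k h1 h2,
            ht2 a ha]
        · intro z
          rw [← hpq, fieldCross_real hr, act_one]
          change _ = _ * (swapData K k).U z + _
          ring
        · exact neg_ne_zero.2 (inv_ne_zero (sub_ne_zero.2 (swapData K k).x_ne))
        · intro x h1 h2
          have := inv_simple_mul_le (P := fun a b => i.at a = i.at b ∧ D.IsReal (i.at a))
            (fun a b h => ⟨h.1.symm, h.1 ▸ h.2⟩) k x.1
          simp only [weight, Prod.fst_mul, Prod.snd_mul, one_mul]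
          omega
        · have := inv_simple_mul_of_lt (P := fun a b => i.at a = i.at b ∧ D.IsReal (i.at a)) k
            top.1 hk ⟨by rw [hlo htop1, hhi htop1, hpq], by rwa [hlo htop1]⟩
          simp only [weight, Prod.fst_mul, Prod.snd_mul, one_mul]
          omega
        · intro x h1 h2
          exact ⟨hsw h1, by rw [hself]; exact h2⟩
        · exact fun _ => ⟨rfl, fun x h1 h2 => ⟨by rw [one_mul], by rwa [hself, one_mul],
            by rwa [hself, one_mul]⟩⟩
      -- Swapping the x of imaginary strands changes no real inversions, so in this case the x-swap
      -- alone is weightless.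
      · have hinv : ∀ {σ : Equiv.Perm (Fin (ht ν))}, i.perm σ = j →
            inv (fun a b => i.at a = i.at b ∧ D.IsReal (i.at a)) (simple k * σ) =
              inv (fun a b => i.at a = i.at b ∧ D.IsReal (i.at a)) σ := by
          intro σ h
          refine inv_simple_mul_of_not k σ (fun g => hr ?_) fun g => hr ?_
          · rw [← hlo h]; exact g.2
          · rw [hpq, ← hhi h]; exact g.2
        refine ⟨(simple k, simple k), (simple k, 1), -((swapData K k).y - (swapData K k).y')⁻¹,
          ((swapData K k).y - (swapData K k).y')⁻¹, 1, rfl, ?_, ?_, ?_, ?_, ?_, ?_, ?_⟩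
        · intro a ha
          rw [Prod.fst_mul, Prod.snd_mul, Equiv.Perm.mul_apply, Equiv.Perm.mul_apply, ht2 a ha]
        · intro z
          rw [← hpq, fieldCross_imag hr, swapData_UV]
          change (act (simple k, 1) z - _) / _ = _
          ring
        · exact neg_ne_zero.2 (inv_ne_zero (sub_ne_zero.2 (swapData K k).y_ne))
        · intro x h1 h2
          have := inv_simple_mul_le (P := fun a b => i.at a = i.at b ∧ ¬ D.IsReal (i.at a))
            (fun a b h => ⟨h.1.symm, h.1 ▸ h.2⟩) k x.2
          simp only [weight, Prod.fst_mul, Prod.snd_mul, hinv h1]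
          omega
        -- Transfers the inequality of preimages, known for the x-part by reducedness, to the
        -- y-part.
        · have e : ∀ {l}, ¬ D.IsReal (j.at l) → top.2⁻¹ l = top.1⁻¹ l := by
            intro l hl
            rw [Equiv.Perm.inv_eq_iff_eq, ht2 _ (by rwa [Seq.at_inv htop1])]
            simp
          have hr' : ¬ D.IsReal (j.at k.hi) := by rwa [← hpq]
          have := inv_simple_mul_of_lt (P := fun a b => i.at a = i.at b ∧ ¬ D.IsReal (i.at a)) k
            top.2 (by rwa [e hr, e hr'])
            ⟨by rw [hlo htop2, hhi htop2, hpq], by rwa [hlo htop2]⟩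
          simp only [weight, Prod.fst_mul, Prod.snd_mul, hinv htop1]
          omega
        · exact fun x h1 h2 => ⟨hsw h1, hsw h2⟩
        · refine fun _ => ⟨rfl, fun x h1 h2 => ⟨?_, hsw h1, by rw [hself]; exact h2⟩⟩
          simp only [weight, Prod.fst_mul, Prod.snd_mul, hinv h1, one_mul, le_refl]
    · have hne : ∀ {σ : Equiv.Perm (Fin (ht ν))}, i.perm σ = j →
          i.at (σ⁻¹ k.lo) ≠ i.at (σ⁻¹ k.hi) := by
        intro σ h
        rw [hlo h, hhi h]
        exact hpq
      have hW : ∀ x : Equiv.Perm (Fin (ht ν)) × Equiv.Perm (Fin (ht ν)), i.perm x.1 = j →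
          i.perm x.2 = j → weight D i ((simple k, simple k) * x) = weight D i x := by
        intro x h1 h2
        rw [weight, weight, Prod.fst_mul, Prod.snd_mul,
          inv_simple_mul_of_not k x.1 (fun g => hne h1 g.1) (fun g => hne h1 g.1.symm),
          inv_simple_mul_of_not k x.2 (fun g => hne h2 g.1) (fun g => hne h2 g.1.symm)]
      refine ⟨(simple k, simple k), 1, edgeFactor O (j.at k.lo) (j.at k.hi) (swapData K k).x
        (swapData K k).x', 0, 0, rfl, ?_, ?_, edgeFactor_var_ne_zero O hpq k,
        fun x h1 h2 => (hW x h1 h2).le, hW top htop1 htop2, fun x h1 h2 => ⟨hsw h1, hsw h2⟩,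
        fun h => absurd rfl h⟩
      · intro a ha
        rw [Prod.fst_mul, Prod.snd_mul, Equiv.Perm.mul_apply, Equiv.Perm.mul_apply, ht2 a ha]
      · intro z
        rw [fieldCross_ne hpq, swapData_UV, zero_mul, add_zero]

end Leading

/-! ### Independence of the operators and faithfulness. -/

section Faithful

variable {I : Type u} {K : Type v} [Field K] {D : BorcherdsCartanDatum I} {ν : I →₀ ℕ}
  [Fintype I] [DecidableEq I]

theorem polyRep_tWord (O : D.Orientation) (w : List (Crossing (ht ν))) (i : Seq ν) :
    polyRep O (tWord K D w i) = opAt i (i.perm (wordPerm w)) (wordLin O i w) := by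
  induction w with
  | nil => exact polyRep_e O i
  | cons k w ih =>
    rw [tWord, map_mul, polyRep_t, ih, opAt_mul_opAt, Seq.perm_wordPerm_cons]
    rfl

theorem polyRep_phi (O : D.Orientation) (i : Seq ν) (p : MvPolynomial (Fin (ht ν)) K)
    (f : XY K (ht ν)) : polyRep O (phi K D i p) (Pol.of i f) =
      Pol.of i (MvPolynomial.rename Sum.inl p * f) := by
  have hC : ∀ (c : K) (f : XY K (ht ν)), Pol.of i (c • f) = c • (Pol.of i f : Pol K ν) :=
    fun c f => map_smul (DirectSum.lof K (Seq ν) (fun i => PolAt K i) i) c f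
  have hadd : ∀ f g : XY K (ht ν), (Pol.of i (f + g) : Pol K ν) = Pol.of i f + Pol.of i g :=
    fun f g => map_add (DirectSum.lof K (Seq ν) (fun i => PolAt K i) i) f g
  induction p using MvPolynomial.induction_on generalizing f with
  | C c =>
    rw [MvPolynomial.rename_C, ← MvPolynomial.algebraMap_eq, AlgHom.commutes, AlgHom.commutes,
      Module.algebraMap_end_apply, ← hC, MvPolynomial.smul_eq_C_mul]
  | add p q hp hq =>
    rw [map_add, map_add, map_add, LinearMap.add_apply, hp, hq, add_mul, hadd]
  | mul_X p k hp =>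
    rw [map_mul, map_mul, map_mul, Module.End.mul_apply, phi_X, polyRep_x, opAt_of, hp,
      MvPolynomial.rename_X, mul_assoc]
    rfl

variable (K D) in
/-- The map `(p_ω)_ω ↦ ∑ τ_{w_ω} p_ω(x)` for a family of words `w_ω`. -/
noncomputable def wordMap {Ω : Type*} [Fintype Ω] (w : Ω → List (Crossing (ht ν))) (i : Seq ν) :
    (Ω → MvPolynomial (Fin (ht ν)) K) →ₗ[K] R K D ν :=
  ∑ ω, LinearMap.mulLeft K (tWord K D (w ω) i) ∘ₗ (phi K D i).toLinearMap ∘ₗ LinearMap.proj ω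

theorem wordMap_apply {Ω : Type*} [Fintype Ω] (w : Ω → List (Crossing (ht ν))) (i : Seq ν)
    (p : Ω → MvPolynomial (Fin (ht ν)) K) :
    wordMap K D w i p = ∑ ω, tWord K D (w ω) i * phi K D i (p ω) := by
  simp [wordMap]

theorem wordMap_single {Ω : Type*} [Fintype Ω] [DecidableEq Ω] (w : Ω → List (Crossing (ht ν)))
    (i : Seq ν) (ω : Ω) (m : Fin (ht ν) → ℕ) :
    wordMap K D w i (Pi.single ω
      (MvPolynomial.monomial (Finsupp.equivFunOnFinite.symm m) (1 : K))) =
        tWord K D (w ω) i * xMonomial K D m i := by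
  rw [wordMap_apply, Finset.sum_eq_single ω]
  · rw [Pi.single_eq_same, phi_monomial, one_smul]
    rfl
  · intro ω' _ hne
    rw [Pi.single_eq_of_ne hne, map_zero, mul_zero]
  · exact fun h => absurd (Finset.mem_univ _) h

/-- The leading automorphisms are distinct because their x-parts are the permutations ω themselves.
-/
theorem polyRep_wordMap_injective (O : D.Orientation) {i j : Seq ν}
    {red : {ω : Equiv.Perm (Fin (ht ν)) // i.perm ω = j} → List (Crossing (ht ν))}
    (hred : ∀ ω, IsReducedExpr (red ω) ω.1) :
    Function.Injective ((polyRep O).toLinearMap ∘ₗ wordMap K D red i) := by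
  classical
  rw [injective_iff_map_eq_zero]
  intro p hp
  choose top c ht1 _ hT hc _ hlt using fun ω => exists_leading (K := K) O i (w := red ω) (by
    rw [Reduced, ((isReducedExpr_iff _ _).1 (hred ω)).1, ((isReducedExpr_iff _ _).1 (hred ω)).2])
  have hq : (fun ω => (MvPolynomial.rename Sum.inl (p ω) : XY K (ht ν))) = 0 := by
    refine eq_zero_of_sum_expansion hT (weight D i) (top := top) ?_ hc hlt fun f => ?_
    · intro ω ω' h
      apply Subtype.ext
      rw [← (hred ω).1, ← (hred ω').1, ← ht1, ← ht1, h]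
    · apply Pol.of_injective (K := K) j
      have h := LinearMap.congr_fun hp (Pol.of i f)
      rw [LinearMap.comp_apply, wordMap_apply, AlgHom.toLinearMap_apply, map_sum,
        LinearMap.sum_apply, LinearMap.zero_apply] at h
      refine Eq.trans ?_ (h.trans (map_zero
        (DirectSum.lof K (Seq ν) (fun i => PolAt K i) j)).symm)
      refine (map_sum (DirectSum.lof K (Seq ν) (fun i => PolAt K i) j) _ _).trans ?_
      refine Finset.sum_congr rfl fun ω _ => ?_
      rw [map_mul (polyRep O), Module.End.mul_apply, polyRep_phi, polyRep_tWord, opAt_of, (hred ω).1, ω.2]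
      rfl
  funext ω
  exact MvPolynomial.rename_injective _ Sum.inl_injective
    ((congrFun hq ω).trans (map_zero _).symm)

/-- Image under an injective linear map of the monomial basis of a product of copies of K[x_1, …,
x_n], one for each ω. -/
theorem linearIndependent_polyRep (O : D.Orientation) {i j : Seq ν}
    {red : {ω : Equiv.Perm (Fin (ht ν)) // i.perm ω = j} → List (Crossing (ht ν))}
    (hred : ∀ ω, IsReducedExpr (red ω) ω.1) :
    LinearIndependent K
      fun p : {ω : Equiv.Perm (Fin (ht ν)) // i.perm ω = j} × (Fin (ht ν) → ℕ) =>
        (polyRep O).toLinearMap (tWord K D (red p.1) i * xMonomial K D p.2 i) := by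
  classical
  let b := Pi.basis fun _ : {ω : Equiv.Perm (Fin (ht ν)) // i.perm ω = j} =>
    MvPolynomial.basisMonomials (Fin (ht ν)) K
  let s : {ω : Equiv.Perm (Fin (ht ν)) // i.perm ω = j} × (Fin (ht ν) → ℕ) →
      Σ _ : {ω : Equiv.Perm (Fin (ht ν)) // i.perm ω = j}, Fin (ht ν) →₀ ℕ :=
    fun p => ⟨p.1, Finsupp.equivFunOnFinite.symm p.2⟩
  have hs : Function.Injective s := by
    rintro ⟨ω, m⟩ ⟨ω', m'⟩ h
    simp only [s, Sigma.mk.injEq, heq_eq_eq] at h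
    exact Prod.ext h.1 (Finsupp.equivFunOnFinite.symm.injective h.2)
  have h := (b.linearIndependent.comp s hs).map_injOn _
    (polyRep_wordMap_injective (K := K) O hred).injOn
  have hb : ((polyRep O).toLinearMap ∘ₗ wordMap K D red i) ∘ b ∘ s = fun p =>
      (polyRep O).toLinearMap (tWord K D (red p.1) i * xMonomial K D p.2 i) := by
    funext p
    rw [← wordMap_single, Function.comp_apply, LinearMap.comp_apply, Function.comp_apply,
      Pi.basis_apply, MvPolynomial.coe_basisMonomials]
  rw [hb] at h
  exact h

/-- Each 1_j z 1_i lies in a span whose spanning family acts by independent operators, so the kernel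
meets that span only in 0; z is the sum of these pieces. -/
theorem polyRep_injective (O : D.Orientation) :
    Function.Injective (polyRep (K := K) (D := D) (ν := ν) O) := by
  rw [injective_iff_map_eq_zero]
  intro z hz
  have key : ∀ i j : Seq ν, e K D j * z * e K D i = 0 := by
    intro i j
    choose red hred using
      fun ω : {ω : Equiv.Perm (Fin (ht ν)) // i.perm ω = j} => exists_reduced ω.1
    have hred' : ∀ ω, IsReducedExpr (red ω) ω.1 := fun ω => (isReducedExpr_iff _ _).2 (hred ω)
    have hmem : e K D j * z * e K D i ∈ component K D j i := ⟨z, by simp [mul_assoc]⟩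
    rw [← span_eq_component hred'] at hmem
    have h0 : polyRep O (e K D j * z * e K D i) = 0 := by
      rw [map_mul, map_mul, hz, mul_zero, zero_mul]
    exact Submodule.disjoint_def.1 (Submodule.range_ker_disjoint
      (linearIndependent_polyRep (K := K) O hred')) _ hmem h0
  rw [← one_mul z, ← mul_one (1 * z), ← sum_e (K := K) (D := D), Finset.sum_mul, Finset.sum_mul_sum]
  exact Finset.sum_eq_zero fun j _ => Finset.sum_eq_zero fun i _ => key i j

end Faithful

/-- The basis statement mentions no orientation, but its proof acts on 𝒫_ν and so needs one; any
enumeration of the vertices provides it. -/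
theorem BorcherdsCartanDatum.nonempty_orientation {I : Type u} [Fintype I]
    (D : BorcherdsCartanDatum I) : Nonempty D.Orientation := by
  let φ := Fintype.equivFin I
  exact ⟨{
    arrow := fun i j => φ i < φ j ∧ D.form i j ≠ 0
    edge_of_arrow := fun i j h => ⟨fun e => h.1.ne (congrArg φ e), h.2⟩
    arrow_or := fun i j hij h => (lt_or_gt_of_ne fun e => hij (φ.injective e)).imp
      (fun g => ⟨g, h⟩) fun g => ⟨g, by rwa [D.form_comm]⟩
    not_both := fun i j h g => lt_asymm h.1 g.1 }⟩

end KLR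

theorem mainTheorem5 {I : Type*} [Fintype I] [DecidableEq I] (K : Type*) [Field K] [IsAlgClosed K]
    (D : KLR.BorcherdsCartanDatum I) (ν : I →₀ ℕ) :
    (∀ (i j : KLR.Seq ν)
      (red : {ω : Equiv.Perm (Fin (KLR.ht ν)) // i.perm ω = j} → List (KLR.Crossing (KLR.ht ν))),
      (∀ ω, KLR.IsReducedExpr (red ω) ω.1) →
        LinearIndependent K
          (fun p : {ω : Equiv.Perm (Fin (KLR.ht ν)) // i.perm ω = j} × (Fin (KLR.ht ν) → ℕ) =>
            KLR.tWord K D (red p.1) i * KLR.xMonomial K D p.2 i) ∧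
        Submodule.span K (Set.range
          (fun p : {ω : Equiv.Perm (Fin (KLR.ht ν)) // i.perm ω = j} × (Fin (KLR.ht ν) → ℕ) =>
            KLR.tWord K D (red p.1) i * KLR.xMonomial K D p.2 i)) = KLR.component K D j i) ∧
    (∀ O : D.Orientation, ∃ ρ : KLR.R K D ν →ₐ[K] Module.End K (KLR.Pol K ν),
      KLR.IsPolynomialAction O ρ ∧ Function.Injective ρ) := by
  refine ⟨fun i j red hred => ⟨?_, KLR.span_eq_component hred⟩, fun O =>
    ⟨KLR.polyRep O, KLR.isPolynomialAction_polyRep O, KLR.polyRep_injective O⟩⟩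
  obtain ⟨O⟩ := D.nonempty_orientation
  exact LinearIndependent.of_comp _ (KLR.linearIndependent_polyRep O hred)
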